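/- Let $B\subset\mathbb{R}^3$ be the unit ball, with boundary the unit sphere $\mathbb{S}^2$, exterior unit normal $\nu(\mathbf{x})=\mathbf{x}$ and surface measure $ds$. For $k\ge 0$ let $G_k(\mathbf{x})=-\dfrac{e^{ik|\mathbf{x}|}}{4\pi|\mathbf{x}|}$, and let $$(\mathcal{K}_B^k)^*[\phi](\mathbf{x})=\mathrm{p.v.}\int_{\mathbb{S}^2}\frac{\partial G_k(\mathbf{x}-\mathbf{y})}{\partial\nu(\mathbf{x})}\,\phi(\mathbf{y})\,ds_{\mathbf{y}},\qquad \mathbf{x}\in\mathbb{S}^2,$$ be the Neumann–Poincaré operator of the Helmholtz system. Let $P_n$ be the Legendre polynomial of order $n$ and $$c_{n,k}=-\frac12\int_{-1}^1 e^{ik\sqrt{2(1-t)}}P_n(t)\,dt .$$ A spherical harmonic of order $n$ is the restriction to $\mathbb{S}^2$ of a homogeneous harmonic polynomial of degree $n$ with complex coefficients. **Theorem 3.4.** For every $n\ge 0$ and $k\ge 0$ there is exactly one number $\tau_{n,k}\in\mathbb{C}$ such that $(\mathcal{K}_B^k)^*[Y]=\tau_{n,k}Y$ on $\mathbb{S}^2$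 for every spherical harmonic $Y$ of order $n$. For $n$ sufficiently large, $$\tau_{n,k}=\frac{1}{2(2n+1)}+\frac{i}{2}k\,c_{n,k}+\mathcal{O}\Big(\frac{k}{n^{3/2}}\Big),$$ uniformly for $k$ in bounded sets: for every $K>0$ there are $C$ and $N$ such that for all $n\ge N$ and $0\le k\le K$ $$\Big|\tau_{n,k}-\frac{1}{2(2n+1)}-\frac{i}{2}k\,c_{n,k}\Big|\le C\,\frac{k}{n^{3/2}} .$$ Moreover $|c_{n,k}|\le \dfrac{1}{\sqrt{2n+1}}$ for all $n\ge 0$ and $k\ge 0$; in particular $c_{n,k}=\mathcal{O}(1/\sqrt n)$. -/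

import Mathlib

noncomputable section

/-- The Legendre polynomial of order `n`, by the formula of Rodrigues:
`P_n(t) = 1 / (2 ^ n n!) * (d/dt) ^ n (t ^ 2 - 1) ^ n`. -/
def legendreP (n : ℕ) : Polynomial ℝ :=
  Polynomial.C (1 / (2 ^ n * (n.factorial : ℝ))) *
    (Polynomial.derivative^[n] ((Polynomial.X ^ 2 - 1) ^ n))

/-- The coefficient `c_{n,k} = -1/2 ∫_{-1}^1 e^{i k √(2(1-t))} P_n(t) dt`. -/
def cCoeff (n : ℕ) (k : ℝ) : ℂ :=
  -(1 / 2) * ∫ t in (-1 : ℝ)..1,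
    Complex.exp (Complex.I * (k : ℂ) * ((Real.sqrt (2 * (1 - t)) : ℝ) : ℂ)) *
      (((legendreP n).eval t : ℝ) : ℂ)

/-- The unit sphere of `ℝ³`, the boundary of the unit ball. -/
abbrev UnitSphere3 : Type := Metric.sphere (0 : EuclideanSpace ℝ (Fin 3)) 1

/-- The surface measure of the unit sphere of `ℝ³` (of total mass `4π`). -/
def surfaceMeasure : MeasureTheory.Measure UnitSphere3 :=
  (MeasureTheory.volume : MeasureTheory.Measure (EuclideanSpace ℝ (Fin 3))).toSphere

/-- The outgoing fundamental solution of `Δ + k²` in `ℝ³`,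
`G_k(x) = - e^{i k |x|} / (4 π |x|)`. -/
def helmholtzG (k : ℝ) (x : EuclideanSpace ℝ (Fin 3)) : ℂ :=
  -Complex.exp (Complex.I * (k : ℂ) * ((‖x‖ : ℝ) : ℂ)) / (4 * (Real.pi : ℂ) * ((‖x‖ : ℝ) : ℂ))

/-- The normal derivative `∂ G_k(x - y) / ∂ν(x)` for `x ≠ y` on the unit sphere: the derivative of
`G_k` at `x - y` in the direction of the exterior unit normal at `x`, which is `x` itself. -/
def npKernel (k : ℝ) (x y : UnitSphere3) : ℂ :=
  fderiv ℝ (helmholtzG k)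
    ((x : EuclideanSpace ℝ (Fin 3)) - (y : EuclideanSpace ℝ (Fin 3)))
    (x : EuclideanSpace ℝ (Fin 3))

/-- The Neumann-Poincaré operator of the unit ball at frequency `k` maps the density `φ` to `ψ`:
at each point `x` of the sphere the Cauchy principal value of
`∫ ∂ G_k(x - y) / ∂ν(x) φ(y) ds(y)` exists and equals `ψ x`. -/
def IsNeumannPoincareImage (k : ℝ) (φ ψ : UnitSphere3 → ℂ) : Prop :=
  ∀ x : UnitSphere3,
    Filter.Tendsto
      (fun ε : ℝ => ∫ y in {y : UnitSphere3 | ε < dist x y}, npKernel k x y * φ y ∂surfaceMeasure)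
      (nhdsWithin 0 (Set.Ioi 0)) (nhds (ψ x))

/-- `Y` is a (complex) spherical harmonic of order `n` on the unit sphere of `ℝ³`: the restriction
of a homogeneous harmonic polynomial of degree `n`. These functions are the linear span of
`Y_n^m`, `-n ≤ m ≤ n`. -/
def IsSphericalHarmonic (n : ℕ) (Y : UnitSphere3 → ℂ) : Prop :=
  ∃ p : MvPolynomial (Fin 3) ℂ, p.IsHomogeneous n ∧
    (∑ i : Fin 3, MvPolynomial.pderiv i (MvPolynomial.pderiv i p)) = 0 ∧
    ∀ x : UnitSphere3,
      Y x = MvPolynomial.eval (fun i => (((x : EuclideanSpace ℝ (Fin 3)) i : ℝ) : ℂ)) p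

end

noncomputable section

/-! For `x`, `y` on the unit sphere put t = ⟨x, y⟩ and r = |x − y| = √(2(1 − t)). Since ⟨x − y, x⟩ =
r²/2, the kernel depends on t alone: it is (1 − ikr)e^{ikr}/(8πr), only weakly singular, so the
principal value is an ordinary integral. By the Funk–Hecke formula (`funk_hecke`) it multiplies
every harmonic of order n by 2π times the integral of this profile against P_n; this is
`npEigenvalue`. The scalar is unique because some harmonic of order n is nonzero somewhere.

Funk–Hecke is proved for powers t^m by matching two recursions: one for the Legendre moments
(`legendreMoment_succ`), one for sphere integrals, from the divergence identity
`sphereIntegral_X_mul`. The latter is Gaussian integration by parts on ℝ³ read in polar coordinates.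
Density of polynomials in L¹(−1, 1), with the uniform distribution of the height t, gives all
integrable profiles.

For the expansion, write (1 − ikr)e^{ikr}/r = 1/r + (e^{ikr} − 1)/r − ik e^{ikr}. The first term
gives 1/(2(2n+1)) (`integral_legendreP_mul_inv_chord`), the last gives (i/2)k c_{n,k}. For f =
(e^{ikr} − 1)/r, Legendre's equation and integration by parts give n(n+1)∫ f P_n = ∫ f′(1 − t²)P_n′.
As |f′| ≤ 3k²/r and ∫ (1 − t²)P_n′² = 2n(n+1)/(2n+1), the right side is O(k²√n), hence ∫ f P_n =
O(k²/n^{3/2}). The bound on c_{n,k} follows from |e^{ikr}| = 1 and ∫ P_n² = 2/(2n+1). -/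

/-! ### Legendre polynomials: recurrences, differential equation, endpoint values. -/

theorem iterate_derivative_X_mul_succ (n : ℕ) (p : Polynomial ℝ) :
    Polynomial.derivative^[n + 1] (Polynomial.X * p) =
      Polynomial.X * Polynomial.derivative^[n + 1] p +
        ((n : Polynomial ℝ) + 1) * Polynomial.derivative^[n] p := by
  induction n with
  | zero => simp [Polynomial.derivative_mul, add_comm]
  | succ n ih =>
    rw [Function.iterate_succ_apply', ih]
    simp only [Polynomial.derivative_add, Polynomial.derivative_mul, Polynomial.derivative_X,
      Polynomial.derivative_natCast, Polynomial.derivative_one,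
      ← Function.iterate_succ_apply' Polynomial.derivative]
    push_cast
    ring

theorem legendreP_zero : legendreP 0 = 1 := by
  simp [legendreP]

theorem derivative_legendreP_succ (n : ℕ) :
    (legendreP (n + 1)).derivative =
      Polynomial.X * (legendreP n).derivative + ((n : Polynomial ℝ) + 1) * legendreP n := by
  have h : Polynomial.derivative ((Polynomial.X ^ 2 - 1 : Polynomial ℝ) ^ (n + 1)) =
      Polynomial.C (2 * ((n : ℝ) + 1)) * (Polynomial.X * (Polynomial.X ^ 2 - 1) ^ n) := by
    simp [Polynomial.derivative_pow]
    ring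
  have hc : (Polynomial.C (1 / (2 ^ (n + 1) * ((n + 1).factorial : ℝ))) : Polynomial ℝ) *
      Polynomial.C (2 * ((n : ℝ) + 1)) = Polynomial.C (1 / (2 ^ n * (n.factorial : ℝ))) := by
    rw [← Polynomial.C_mul, Nat.factorial_succ]
    congr 1
    push_cast
    field_simp
    ring
  unfold legendreP
  rw [Function.iterate_succ_apply, h, Polynomial.iterate_derivative_C_mul, ← mul_assoc, hc,
    Polynomial.derivative_C_mul, ← Function.iterate_succ_apply' Polynomial.derivative,
    iterate_derivative_X_mul_succ, Polynomial.derivative_C_mul,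
    ← Function.iterate_succ_apply' Polynomial.derivative]
  ring

/-- Differentiate (X² − 1)^{n+2} twice and replace X² by (X² − 1) + 1: what remains are the
Rodrigues powers of orders n + 1 and n. -/
theorem derivative_legendreP_add_two (n : ℕ) :
    (legendreP (n + 2)).derivative =
      (2 * (n : Polynomial ℝ) + 3) * legendreP (n + 1) + (legendreP n).derivative := by
  have h : Polynomial.derivative (Polynomial.derivative
        ((Polynomial.X ^ 2 - 1 : Polynomial ℝ) ^ (n + 2))) =
      Polynomial.C (2 * ((n : ℝ) + 2) * (2 * n + 3)) * (Polynomial.X ^ 2 - 1) ^ (n + 1) +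
        Polynomial.C (4 * ((n : ℝ) + 2) * (n + 1)) * (Polynomial.X ^ 2 - 1) ^ n := by
    simp [Polynomial.derivative_pow, Polynomial.derivative_mul]
    simp only [Polynomial.C_ofNat]
    ring
  have hc : (Polynomial.C (1 / (2 ^ (n + 2) * ((n + 2).factorial : ℝ))) : Polynomial ℝ) *
      Polynomial.C (2 * ((n : ℝ) + 2) * (2 * n + 3)) =
      (2 * (n : Polynomial ℝ) + 3) *
        Polynomial.C (1 / (2 ^ (n + 1) * ((n + 1).factorial : ℝ))) := by
    have : (2 * (n : Polynomial ℝ) + 3) = Polynomial.C (2 * (n : ℝ) + 3) := by simp [Polynomial.C_ofNat]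
    rw [this, ← Polynomial.C_mul, ← Polynomial.C_mul, Nat.factorial_succ (n + 1)]
    congr 1
    push_cast
    field_simp
    ring
  have hd : (Polynomial.C (1 / (2 ^ (n + 2) * ((n + 2).factorial : ℝ))) : Polynomial ℝ) *
      Polynomial.C (4 * ((n : ℝ) + 2) * (n + 1)) =
        Polynomial.C (1 / (2 ^ n * (n.factorial : ℝ))) := by
    rw [← Polynomial.C_mul, Nat.factorial_succ (n + 1), Nat.factorial_succ n]
    congr 1
    push_cast
    field_simp
    ring
  unfold legendreP
  rw [Polynomial.derivative_C_mul, ← Function.iterate_succ_apply' Polynomial.derivative,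
    Function.iterate_succ_apply, Function.iterate_succ_apply, h, iterate_map_add Polynomial.derivative,
    Polynomial.iterate_derivative_C_mul, Polynomial.iterate_derivative_C_mul, mul_add,
    ← mul_assoc, ← mul_assoc, hc, hd, Polynomial.derivative_C_mul,
    ← Function.iterate_succ_apply' Polynomial.derivative]
  ring

theorem X_mul_derivative_legendreP_succ (n : ℕ) :
    Polynomial.X * (legendreP (n + 1)).derivative =
      ((n : Polynomial ℝ) + 1) * legendreP (n + 1) + (legendreP n).derivative := by
  have h1 := derivative_legendreP_succ (n + 1)
  have h2 := derivative_legendreP_add_two n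
  push_cast at h1
  linear_combination h2 - h1

/-- At n = 0 the truncated index `n - 1` is harmless, because the factor n vanishes. -/
theorem X_sq_sub_one_mul_derivative_legendreP (n : ℕ) :
    (Polynomial.X ^ 2 - 1) * (legendreP n).derivative =
      (n : Polynomial ℝ) * (Polynomial.X * legendreP n - legendreP (n - 1)) := by
  cases n with
  | zero => simp [legendreP_zero]
  | succ n =>
    have h1 := X_mul_derivative_legendreP_succ n
    have h2 := derivative_legendreP_succ n
    simp only [Nat.add_sub_cancel]
    push_cast
    linear_combination Polynomial.X * h1 - h2

/-- Legendre's differential equation. -/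
theorem derivative_one_sub_X_sq_mul_derivative_legendreP (n : ℕ) :
    Polynomial.derivative ((1 - Polynomial.X ^ 2) * (legendreP n).derivative) =
      -((n : Polynomial ℝ) * ((n : Polynomial ℝ) + 1)) * legendreP n := by
  cases n with
  | zero => norm_num [legendreP_zero]
  | succ n =>
    have h : (1 - Polynomial.X ^ 2) * (legendreP (n + 1)).derivative =
        ((n + 1 : ℕ) : Polynomial ℝ) * (legendreP n - Polynomial.X * legendreP (n + 1)) := by
      have := X_sq_sub_one_mul_derivative_legendreP (n + 1)
      simp only [Nat.add_sub_cancel] at this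
      linear_combination -this
    have h1 := X_mul_derivative_legendreP_succ n
    rw [h]
    simp only [Polynomial.derivative_mul, Polynomial.derivative_natCast, Polynomial.derivative_sub,
      Polynomial.derivative_X]
    push_cast
    linear_combination -((n : Polynomial ℝ) + 1) * h1

theorem eval_one_legendreP (n : ℕ) : (legendreP n).eval 1 = 1 := by
  induction n with
  | zero => simp [legendreP_zero]
  | succ n ih =>
    have h := congrArg (Polynomial.eval 1) (X_sq_sub_one_mul_derivative_legendreP (n + 1))
    simp [ih] at h
    rcases h with h | h
    · exact absurd h (by positivity)
    · linarith

theorem eval_neg_one_legendreP_succ (n : ℕ) :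
    (legendreP (n + 1)).eval (-1) = -(legendreP n).eval (-1) := by
  have h := congrArg (Polynomial.eval (-1)) (X_sq_sub_one_mul_derivative_legendreP (n + 1))
  simp at h
  rcases h with h | h
  · exact absurd h (by positivity)
  · linarith

theorem eval_neg_one_legendreP_sq (n : ℕ) : (legendreP n).eval (-1) ^ 2 = 1 := by
  induction n with
  | zero => simp [legendreP_zero]
  | succ n ih => rw [eval_neg_one_legendreP_succ, neg_sq, ih]

/-! ### Legendre moments, orthogonality, quadratic integrals and the bound on c_{n,k}. -/

theorem Polynomial.intervalIntegrable_eval (p : Polynomial ℝ) (a b : ℝ) :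
    IntervalIntegrable (fun t => p.eval t) MeasureTheory.volume a b :=
  p.continuous.intervalIntegrable a b

theorem Polynomial.integral_eval_derivative (p : Polynomial ℝ) (a b : ℝ) :
    ∫ t in a..b, p.derivative.eval t = p.eval b - p.eval a :=
  intervalIntegral.integral_eq_sub_of_hasDerivAt (fun t _ => p.hasDerivAt t)
    (p.derivative.intervalIntegrable_eval a b)

/-- The moments of the Legendre polynomials on `[-1, 1]`. -/
def legendreMoment (m n : ℕ) : ℝ := ∫ t in (-1 : ℝ)..1, t ^ m * (legendreP n).eval t

/-- Integrate the derivative of t^m (t² − 1) P_n, which vanishes at ±1. The sphere integrals of ⟨x,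
y⟩^m p(y) obey the same recursion, which is what yields Funk–Hecke. -/
theorem legendreMoment_succ (m n : ℕ) :
    ((m : ℝ) + n + 2) * legendreMoment (m + 1) n =
      m * legendreMoment (m - 1) n + n * legendreMoment m (n - 1) := by
  have hp : Polynomial.derivative
      (Polynomial.X ^ m * ((Polynomial.X ^ 2 - 1) * legendreP n)) =
      ((m : Polynomial ℝ) + (n : Polynomial ℝ) + 2) * (Polynomial.X ^ (m + 1) * legendreP n) -
        ((m : Polynomial ℝ) * (Polynomial.X ^ (m - 1) * legendreP n) +
          (n : Polynomial ℝ) * (Polynomial.X ^ m * legendreP (n - 1))) := by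
    have h := X_sq_sub_one_mul_derivative_legendreP n
    cases m with
    | zero =>
      simp
      linear_combination h
    | succ m =>
      simp [Polynomial.derivative_mul]
      linear_combination Polynomial.X ^ (m + 1) * h
  have h := Polynomial.integral_eval_derivative
    (Polynomial.X ^ m * ((Polynomial.X ^ 2 - 1) * legendreP n)) (-1) 1
  rw [hp] at h
  simp only [Polynomial.eval_sub, Polynomial.eval_add, Polynomial.eval_mul, Polynomial.eval_pow,
    Polynomial.eval_X, Polynomial.eval_natCast, Polynomial.eval_ofNat, Polynomial.eval_one] at h
  have hi : ∀ (c : ℝ) (a b : ℕ), IntervalIntegrable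
      (fun t : ℝ => c * (t ^ a * (legendreP b).eval t)) MeasureTheory.volume (-1) 1 := by
    intro c a b
    apply Continuous.intervalIntegrable
    fun_prop
  rw [intervalIntegral.integral_sub (hi _ _ _) ((hi _ _ _).add (hi _ _ _)),
    intervalIntegral.integral_add (hi _ _ _) (hi _ _ _), intervalIntegral.integral_const_mul,
    intervalIntegral.integral_const_mul, intervalIntegral.integral_const_mul] at h
  norm_num at h
  unfold legendreMoment
  linarith

theorem legendreMoment_zero_succ (n : ℕ) : legendreMoment 0 (n + 1) = 0 := by
  have h := Polynomial.integral_eval_derivative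
    ((1 - Polynomial.X ^ 2) * (legendreP (n + 1)).derivative) (-1) 1
  rw [derivative_one_sub_X_sq_mul_derivative_legendreP] at h
  simp only [Polynomial.eval_sub, Polynomial.eval_neg, Polynomial.eval_add, Polynomial.eval_mul,
    Polynomial.eval_pow, Polynomial.eval_X, Polynomial.eval_natCast, Polynomial.eval_one,
    intervalIntegral.integral_const_mul] at h
  norm_num at h
  rcases h with (h | h) | h
  · exact absurd h (by positivity)
  · exact absurd h (by positivity)
  · simpa [legendreMoment] using h

theorem legendreMoment_zero_zero : legendreMoment 0 0 = 2 := by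
  norm_num [legendreMoment, legendreP_zero]

theorem legendreMoment_eq_zero_of_lt {m n : ℕ} (h : m < n) : legendreMoment m n = 0 := by
  induction m using Nat.strong_induction_on generalizing n with
  | _ m ih =>
    obtain ⟨n, rfl⟩ : ∃ l, n = l + 1 := ⟨n - 1, by omega⟩
    cases m with
    | zero => exact legendreMoment_zero_succ n
    | succ m =>
      have hr := legendreMoment_succ m (n + 1)
      rw [Nat.add_sub_cancel, ih m (by omega) (by omega : m < n)] at hr
      have h0 : (m : ℝ) * legendreMoment (m - 1) (n + 1) = 0 := by
        cases m with
        | zero => simp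
        | succ m => rw [ih (m + 1 - 1) (by omega) (by omega), mul_zero]
      rw [h0, mul_zero, add_zero] at hr
      rcases mul_eq_zero.1 hr with h1 | h1
      · exact absurd h1 (by positivity)
      · exact h1

theorem integral_mul_legendreP_eq_zero {p : Polynomial ℝ} {n : ℕ} (hp : p.degree < n) :
    ∫ t in (-1 : ℝ)..1, p.eval t * (legendreP n).eval t = 0 := by
  simp_rw [Polynomial.eval_eq_sum, Polynomial.sum, Finset.sum_mul]
  rw [intervalIntegral.integral_finsetSum]
  · refine Finset.sum_eq_zero fun m hm => ?_
    simp_rw [mul_assoc]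
    rw [intervalIntegral.integral_const_mul]
    have := legendreMoment_eq_zero_of_lt (m := m) (n := n) (by
      exact_mod_cast (Polynomial.le_degree_of_mem_supp m hm).trans_lt hp)
    simp only [legendreMoment, Polynomial.eval_eq_sum, Polynomial.sum] at this
    rw [this, mul_zero]
  · intro i _
    apply Continuous.intervalIntegrable
    fun_prop

theorem degree_legendreP_le (n : ℕ) : (legendreP n).degree ≤ n := by
  have h : ((Polynomial.X ^ 2 - 1 : Polynomial ℝ) ^ n).natDegree ≤ 2 * n := by
    refine Polynomial.natDegree_pow_le.trans ?_
    have : (Polynomial.X ^ 2 - 1 : Polynomial ℝ).natDegree ≤ 2 := by compute_degree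
    nlinarith
  have h2 := Polynomial.natDegree_iterate_derivative
    ((Polynomial.X ^ 2 - 1 : Polynomial ℝ) ^ n) n
  refine Polynomial.degree_le_of_natDegree_le ?_
  refine (Polynomial.natDegree_C_mul_le _ _).trans ?_
  omega

/-- Integrate (t P²)′ = P² + 2tPP′: the recurrence for tP′ leaves a multiple of P² and a term of
lower degree times P, killed by orthogonality. -/
theorem integral_legendreP_sq (n : ℕ) :
    ∫ t in (-1 : ℝ)..1, (legendreP n).eval t ^ 2 = 2 / (2 * n + 1) := by
  cases n with
  | zero => norm_num [legendreP_zero]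
  | succ n =>
    have h := Polynomial.integral_eval_derivative
      (Polynomial.X * legendreP (n + 1) ^ 2) (-1) 1
    have hd : Polynomial.derivative (Polynomial.X * legendreP (n + 1) ^ 2) =
        (2 * (n : Polynomial ℝ) + 3) * legendreP (n + 1) ^ 2 +
          2 * ((legendreP n).derivative * legendreP (n + 1)) := by
      have := X_mul_derivative_legendreP_succ n
      simp [Polynomial.derivative_mul, Polynomial.derivative_pow]
      rw [Polynomial.C_ofNat]
      linear_combination 2 * legendreP (n + 1) * this
    rw [hd] at h
    simp only [Polynomial.eval_add, Polynomial.eval_mul, Polynomial.eval_pow,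
      Polynomial.eval_X, Polynomial.eval_natCast, Polynomial.eval_ofNat, eval_one_legendreP,
      eval_neg_one_legendreP_sq] at h
    have ho : ∫ t in (-1 : ℝ)..1,
        (legendreP n).derivative.eval t * (legendreP (n + 1)).eval t = 0 := by
      apply integral_mul_legendreP_eq_zero
      refine (Polynomial.degree_derivative_le.trans (degree_legendreP_le n)).trans_lt ?_
      exact_mod_cast Nat.lt_succ_self n
    rw [intervalIntegral.integral_add (by apply Continuous.intervalIntegrable; fun_prop)
      (by apply Continuous.intervalIntegrable; fun_prop), intervalIntegral.integral_const_mul,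
      intervalIntegral.integral_const_mul, ho] at h
    push_cast
    rw [eq_div_iff (by positivity)]
    linarith

/-- Legendre's equation tested against P_n; the boundary terms vanish with 1 − t². -/
theorem integral_one_sub_sq_mul_derivative_legendreP_sq (n : ℕ) :
    ∫ t in (-1 : ℝ)..1, (1 - t ^ 2) * (legendreP n).derivative.eval t ^ 2 =
      (n : ℝ) * (n + 1) * (2 / (2 * n + 1)) := by
  have h := Polynomial.integral_eval_derivative
    ((1 - Polynomial.X ^ 2) * (legendreP n).derivative * legendreP n) (-1) 1
  rw [Polynomial.derivative_mul, derivative_one_sub_X_sq_mul_derivative_legendreP] at h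
  have he : ∀ t : ℝ, (-((n : Polynomial ℝ) * ((n : Polynomial ℝ) + 1)) * legendreP n * legendreP n +
      (1 - Polynomial.X ^ 2) * (legendreP n).derivative * (legendreP n).derivative).eval t =
      (-(n * (n + 1))) * (legendreP n).eval t ^ 2 +
        (1 - t ^ 2) * (legendreP n).derivative.eval t ^ 2 := by
    intro t
    simp
    ring
  simp_rw [he] at h
  rw [intervalIntegral.integral_add (by apply Continuous.intervalIntegrable; fun_prop)
      (by apply Continuous.intervalIntegrable; fun_prop), intervalIntegral.integral_const_mul,
      integral_legendreP_sq] at h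
  simp at h
  linarith

theorem norm_cCoeff_le (n : ℕ) (k : ℝ) : ‖cCoeff n k‖ ≤ 1 / Real.sqrt (2 * (n : ℝ) + 1) := by
  set s := Real.sqrt (2 * (n : ℝ) + 1) with hs
  have hs0 : 0 < s := Real.sqrt_pos.2 (by positivity)
  have hs2 : s ^ 2 = 2 * n + 1 := Real.sq_sqrt (by positivity)
  have hb : ∀ t : ℝ, ‖Complex.exp (Complex.I * (k : ℂ) * ((Real.sqrt (2 * (1 - t)) : ℝ) : ℂ)) *
      (((legendreP n).eval t : ℝ) : ℂ)‖ ≤ 1 / 2 * (1 / s) + s / 2 * (legendreP n).eval t ^ 2 := by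
    intro t
    have h1 : Complex.I * (k : ℂ) * ((Real.sqrt (2 * (1 - t)) : ℝ) : ℂ) =
        ((k * Real.sqrt (2 * (1 - t)) : ℝ) : ℂ) * Complex.I := by
      push_cast
      ring
    rw [norm_mul, h1, Complex.norm_exp_ofReal_mul_I, one_mul, Complex.norm_real, Real.norm_eq_abs]
    -- Pointwise AM–GM replaces Cauchy–Schwarz; the weight s = √(2n+1) makes both halves integrate
    -- to 1/s.
    have h2 : 0 ≤ (1 - s * |(legendreP n).eval t|) ^ 2 / s := by positivity
    have h3 : (1 - s * |(legendreP n).eval t|) ^ 2 / s =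
        1 / s - 2 * |(legendreP n).eval t| + s * (legendreP n).eval t ^ 2 := by
      rw [← sq_abs ((legendreP n).eval t)]
      field_simp
      ring
    linarith
  have h := intervalIntegral.norm_integral_le_of_norm_le (a := (-1 : ℝ)) (b := 1)
    (μ := MeasureTheory.volume) (by norm_num) (Filter.Eventually.of_forall fun t _ => hb t)
    (by apply Continuous.intervalIntegrable; fun_prop)
  rw [intervalIntegral.integral_add (by simp)
    (by apply Continuous.intervalIntegrable; fun_prop),
    intervalIntegral.integral_const_mul (s / 2), integral_legendreP_sq, ← hs2] at h
  have he : (∫ _t in (-1 : ℝ)..1, 1 / 2 * (1 / s)) + s / 2 * (2 / s ^ 2) = 2 * (1 / s) := by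
    rw [intervalIntegral.integral_const, smul_eq_mul]
    field_simp
    norm_num
  rw [he] at h
  rw [cCoeff, norm_mul]
  norm_num at h ⊢
  linarith

/-! ### Gaussian integrals on ℝ³ and the divergence identity on the sphere. -/

/-- The value of a complex polynomial at a point of `ℝ³`. -/
def evalReal (q : MvPolynomial (Fin 3) ℂ) (y : EuclideanSpace ℝ (Fin 3)) : ℂ :=
  MvPolynomial.eval (fun i => ((y i : ℝ) : ℂ)) q

theorem continuous_evalReal (q : MvPolynomial (Fin 3) ℂ) : Continuous (evalReal q) := by
  unfold evalReal
  simp_rw [MvPolynomial.eval_eq']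
  fun_prop

theorem evalReal_smul {q : MvPolynomial (Fin 3) ℂ} {d : ℕ} (hq : q.IsHomogeneous d) (r : ℝ)
    (y : EuclideanSpace ℝ (Fin 3)) : evalReal q (r • y) = (r : ℂ) ^ d * evalReal q y := by
  unfold evalReal
  rw [MvPolynomial.eval_eq', MvPolynomial.eval_eq', Finset.mul_sum]
  refine Finset.sum_congr rfl fun s hs => ?_
  have hd : ∑ i, s i = d := by
    rw [← Finsupp.degree_eq_sum]
    rw [Finsupp.degree_eq_weight_one]
    exact hq (MvPolynomial.mem_support_iff.1 hs)
  simp_rw [PiLp.smul_apply, smul_eq_mul, Complex.ofReal_mul, mul_pow, Finset.prod_mul_distrib]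
  rw [Finset.prod_pow_eq_pow_sum, hd]
  ring

theorem norm_evalReal_monomial_le (s : Fin 3 →₀ ℕ) (a : ℂ) (y : EuclideanSpace ℝ (Fin 3)) :
    ‖evalReal (MvPolynomial.monomial s a) y‖ ≤ ‖a‖ * ‖y‖ ^ (∑ i, s i) := by
  unfold evalReal
  rw [MvPolynomial.eval_monomial, norm_mul, Finsupp.prod_fintype _ _ (by simp), norm_prod,
    ← Finset.prod_pow_eq_pow_sum]
  gcongr with i
  rw [norm_pow, Complex.norm_real]
  gcongr
  exact PiLp.norm_apply_le y i

theorem hasLineDerivAt_evalReal (q : MvPolynomial (Fin 3) ℂ) (y : EuclideanSpace ℝ (Fin 3))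
    (i : Fin 3) :
    HasLineDerivAt ℝ (evalReal q) (evalReal (MvPolynomial.pderiv i q) y) y
      (EuclideanSpace.single i 1) := by
  unfold HasLineDerivAt evalReal
  induction q using MvPolynomial.induction_on with
  | C a => simpa using hasDerivAt_const (0 : ℝ) a
  | add p q hp hq => simpa using hp.fun_add hq
  | mul_X p j hp =>
    have hX : HasDerivAt (fun t : ℝ =>
        (((y + t • EuclideanSpace.single i (1 : ℝ)) j : ℝ) : ℂ))
        ((if j = i then 1 else 0 : ℝ) : ℂ) 0 := by
      apply HasDerivAt.ofReal_comp
      simp only [PiLp.add_apply, PiLp.smul_apply, PiLp.single_apply, smul_eq_mul]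
      simpa using ((hasDerivAt_id (0 : ℝ)).mul_const (if j = i then (1 : ℝ) else 0)).const_add (y j)
    have h := hp.fun_mul hX
    simp only [zero_smul, add_zero] at h
    simp only [map_mul, MvPolynomial.eval_X]
    refine h.congr_deriv ?_
    rw [MvPolynomial.pderiv_mul, MvPolynomial.pderiv_X]
    by_cases hij : j = i
    · subst hij; simp
    · simp [hij]

/-- The weight `exp (-‖y‖² / 2)` on `ℝ³`. -/
def gaussWeight (y : EuclideanSpace ℝ (Fin 3)) : ℂ := ((Real.exp (-(1 / 2) * ‖y‖ ^ 2) : ℝ) : ℂ)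

theorem hasLineDerivAt_gaussWeight (y : EuclideanSpace ℝ (Fin 3)) (i : Fin 3) :
    HasLineDerivAt ℝ gaussWeight (-((y i : ℝ) : ℂ) * gaussWeight y) y
      (EuclideanSpace.single i 1) := by
  unfold HasLineDerivAt gaussWeight
  have hn : ∀ t : ℝ, ‖y + t • EuclideanSpace.single i (1 : ℝ)‖ ^ 2 =
      ‖y‖ ^ 2 + t * (2 * y i) + t ^ 2 := by
    intro t
    rw [norm_add_sq_real, inner_smul_right, EuclideanSpace.inner_single_right, norm_smul]
    simp
    ring
  simp_rw [hn]
  have h : HasDerivAt (fun t : ℝ => -(1 / 2) * (‖y‖ ^ 2 + t * (2 * y i) + t ^ 2)) (-(y i)) 0 := by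
    have := ((((hasDerivAt_id (0 : ℝ)).mul_const (2 * y i)).const_add (‖y‖ ^ 2)).fun_add
      (hasDerivAt_pow 2 (0 : ℝ))).const_mul (-(1 / 2) : ℝ)
    refine this.congr_deriv ?_
    simp
  refine h.exp.ofReal_comp.congr_deriv ?_
  simp
  ring

theorem integrable_evalReal_mul_gaussWeight (q : MvPolynomial (Fin 3) ℂ) :
    MeasureTheory.Integrable (fun y => evalReal q y * gaussWeight y) := by
  have hw : Continuous gaussWeight := by unfold gaussWeight; fun_prop
  induction q using MvPolynomial.induction_on' with
  | add p q hp hq =>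
    refine (hp.add hq).congr (Filter.Eventually.of_forall fun y => ?_)
    simp [evalReal, add_mul]
  | monomial s a =>
    have h1 : MeasureTheory.Integrable (fun y : EuclideanSpace ℝ (Fin 3) =>
        ‖y‖ ^ (∑ i, s i) * Real.exp (-(1 / 2) * ‖y‖ ^ 2)) := by
      rw [MeasureTheory.integrable_fun_norm_addHaar MeasureTheory.volume
        (f := fun r : ℝ => r ^ (∑ i, s i) * Real.exp (-(1 / 2) * r ^ 2))]
      have := integrableOn_rpow_mul_exp_neg_mul_sq (b := 1 / 2) (by norm_num)
        (s := ((2 + ∑ i, s i : ℕ) : ℝ)) (by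
          have : (0 : ℝ) ≤ ((2 + ∑ i, s i : ℕ) : ℝ) := Nat.cast_nonneg _
          linarith)
      simp_rw [Real.rpow_natCast, pow_add] at this
      simpa [mul_assoc] using this
    refine (h1.const_mul ‖a‖).mono' ((continuous_evalReal _).mul hw).aestronglyMeasurable
      (Filter.Eventually.of_forall fun y => ?_)
    rw [norm_mul, gaussWeight, Complex.norm_real, Real.norm_of_nonneg (Real.exp_pos _).le,
      ← mul_assoc]
    gcongr
    exact norm_evalReal_monomial_le s a y

theorem integral_X_mul_gaussWeight (q : MvPolynomial (Fin 3) ℂ) (i : Fin 3) :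
    ∫ y, evalReal (MvPolynomial.X i * q) y * gaussWeight y =
      ∫ y, evalReal (MvPolynomial.pderiv i q) y * gaussWeight y := by
  have hX : ∀ y, evalReal q y * (-((y i : ℝ) : ℂ) * gaussWeight y) =
      -(evalReal (MvPolynomial.X i * q) y * gaussWeight y) := by
    intro y
    simp [evalReal]
    ring
  have h := integral_bilinear_hasLineDerivAt_right_eq_neg_left_of_integrable
    (μ := MeasureTheory.volume) (B := ContinuousLinearMap.mul ℝ ℂ)
    (f := evalReal q) (f' := evalReal (MvPolynomial.pderiv i q)) (g := gaussWeight)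
    (g' := fun y => -((y i : ℝ) : ℂ) * gaussWeight y) (v := EuclideanSpace.single i 1)
    (integrable_evalReal_mul_gaussWeight _)
    (by
      simp_rw [ContinuousLinearMap.mul_apply', hX]
      exact (integrable_evalReal_mul_gaussWeight _).neg)
    (integrable_evalReal_mul_gaussWeight _) (fun y _ => hasLineDerivAt_evalReal q y i)
    (fun y _ => hasLineDerivAt_gaussWeight y i)
  simp_rw [ContinuousLinearMap.mul_apply', hX] at h
  rw [MeasureTheory.integral_neg] at h
  exact neg_injective h

/-- The radial Gaussian moments in `ℝ³`. -/
def radialMoment (d : ℕ) : ℝ := ∫ r in Set.Ioi (0 : ℝ), r ^ (d + 2) * Real.exp (-(1 / 2) * r ^ 2)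

theorem radialMoment_eq (d : ℕ) :
    radialMoment d = (1 / 2 : ℝ) ^ (-((d : ℝ) + 3) / 2) * (1 / 2) *
      Real.Gamma (((d : ℝ) + 3) / 2) := by
  have h := integral_rpow_mul_exp_neg_mul_rpow (p := 2) (q := (d : ℝ) + 2) (b := 1 / 2)
    (by norm_num) (by linarith [(Nat.cast_nonneg d : (0 : ℝ) ≤ d)]) (by norm_num)
  have he : (d : ℝ) + 2 + 1 = d + 3 := by ring
  rw [he] at h
  rw [← h, radialMoment]
  refine MeasureTheory.setIntegral_congr_fun measurableSet_Ioi fun r _ => ?_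
  have : r ^ ((d : ℝ) + 2) = r ^ (d + 2) := by exact_mod_cast Real.rpow_natCast r (d + 2)
  simp only [this, Real.rpow_two]

theorem radialMoment_pos (d : ℕ) : 0 < radialMoment d := by
  rw [radialMoment_eq]
  have := Real.Gamma_pos_of_pos (s := ((d : ℝ) + 3) / 2) (by positivity)
  positivity

/-- This ratio is the constant that appears when Gaussian integration by parts is transferred to the
sphere. -/
theorem radialMoment_add_two (d : ℕ) : radialMoment (d + 2) = (d + 3) * radialMoment d := by
  rw [radialMoment_eq, radialMoment_eq]
  have h1 : (((d + 2 : ℕ) : ℝ) + 3) / 2 = ((d : ℝ) + 3) / 2 + 1 := by push_cast; ring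
  have h2 : -(((d + 2 : ℕ) : ℝ) + 3) / 2 = -((d : ℝ) + 3) / 2 - 1 := by push_cast; ring
  rw [h1, h2, Real.Gamma_add_one (by positivity), Real.rpow_sub_one (by norm_num)]
  ring

instance : MeasureTheory.IsFiniteMeasure surfaceMeasure := by
  unfold surfaceMeasure
  infer_instance

theorem integrable_surfaceMeasure_of_continuous {f : UnitSphere3 → ℂ} (hf : Continuous f) :
    MeasureTheory.Integrable f surfaceMeasure := by
  exact hf.integrable_of_hasCompactSupport (HasCompactSupport.of_compactSpace f)

theorem continuous_evalReal_sphere (q : MvPolynomial (Fin 3) ℂ) :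
    Continuous fun y : UnitSphere3 => evalReal q y :=
  (continuous_evalReal q).comp continuous_subtype_val

/-- The integral of a polynomial over the unit sphere. -/
def sphereIntegral : MvPolynomial (Fin 3) ℂ →ₗ[ℂ] ℂ where
  toFun q := ∫ y : UnitSphere3, evalReal q y ∂surfaceMeasure
  map_add' p q := by
    rw [← MeasureTheory.integral_add
      (integrable_surfaceMeasure_of_continuous (continuous_evalReal_sphere p))
      (integrable_surfaceMeasure_of_continuous (continuous_evalReal_sphere q))]
    simp [evalReal]
  map_smul' c q := by
    simp [evalReal, MeasureTheory.integral_const_mul]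

theorem sphereIntegral_apply (q : MvPolynomial (Fin 3) ℂ) :
    sphereIntegral q = ∫ y : UnitSphere3, evalReal q y ∂surfaceMeasure := rfl

theorem integral_evalReal_mul_gaussWeight {q : MvPolynomial (Fin 3) ℂ} {d : ℕ}
    (hq : q.IsHomogeneous d) :
    ∫ y, evalReal q y * gaussWeight y = sphereIntegral q * (radialMoment d : ℂ) := by
  have hdim : Module.finrank ℝ (EuclideanSpace ℝ (Fin 3)) = 3 := by simp
  have hmp := (MeasureTheory.volume : MeasureTheory.Measure
    (EuclideanSpace ℝ (Fin 3))).measurePreserving_homeomorphUnitSphereProd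
  have h := hmp.integral_comp (Homeomorph.measurableEmbedding _)
    (fun p => evalReal q p.1 * (((p.2.1 ^ d * Real.exp (-(1 / 2) * p.2.1 ^ 2) : ℝ)) : ℂ))
  rw [MeasureTheory.integral_prod_mul (fun p : UnitSphere3 => evalReal q p)
    (fun r : Set.Ioi (0 : ℝ) => (((r.1 ^ d * Real.exp (-(1 / 2) * r.1 ^ 2) : ℝ)) : ℂ))] at h
  have hl : ∫ y, evalReal q y * gaussWeight y = ∫ x : ({(0)}ᶜ : Set (EuclideanSpace ℝ (Fin 3))),
      evalReal q x.1 * gaussWeight x.1 ∂(MeasureTheory.volume.comap Subtype.val) := by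
    rw [MeasureTheory.integral_subtype_comap (MeasurableSet.singleton _).compl
      fun x => evalReal q x * gaussWeight x, MeasureTheory.restrict_compl_singleton]
  rw [hl, sphereIntegral_apply, surfaceMeasure]
  convert h using 2
  · ext x
    have hx : ‖x.1‖ ≠ 0 := norm_ne_zero_iff.2 x.2
    simp only [homeomorphUnitSphereProd_apply_fst_coe, homeomorphUnitSphereProd_apply_snd_coe]
    rw [evalReal_smul hq, gaussWeight]
    push_cast
    have : (‖x.1‖ : ℂ) ≠ 0 := by exact_mod_cast hx
    field_simp
    rw [mul_assoc, ← mul_pow, one_div_mul_cancel this, one_pow, mul_one]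
  · rw [integral_complex_ofReal, hdim]
    congr 1
    -- The radial measure has density r², which raises r^d to the r^{d+2} of `radialMoment`.
    simp only [MeasureTheory.Measure.volumeIoiPow, ENNReal.ofReal]
    rw [integral_withDensity_eq_integral_smul (by fun_prop),
      MeasureTheory.integral_subtype_comap measurableSet_Ioi
        fun a : ℝ => Real.toNNReal (a ^ (3 - 1)) • (a ^ d * Real.exp (-(1 / 2) * a ^ 2)),
      radialMoment]
    refine MeasureTheory.setIntegral_congr_fun measurableSet_Ioi fun r hr => ?_
    simp only [NNReal.smul_def]
    rw [Real.coe_toNNReal _ (pow_nonneg (le_of_lt hr) _), smul_eq_mul]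
    ring

/-- The divergence theorem on the ball for polynomials. -/
theorem sphereIntegral_X_mul {q : MvPolynomial (Fin 3) ℂ} {d : ℕ} (hq : q.IsHomogeneous d)
    (i : Fin 3) :
    ((d : ℂ) + 2) * sphereIntegral (MvPolynomial.X i * q) =
      sphereIntegral (MvPolynomial.pderiv i q) := by
  have hXq : (MvPolynomial.X i * q).IsHomogeneous (1 + d) := (MvPolynomial.isHomogeneous_X _ i).mul hq
  have h := integral_X_mul_gaussWeight q i
  rw [integral_evalReal_mul_gaussWeight hXq, integral_evalReal_mul_gaussWeight hq.pderiv] at h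
  -- Degree 0 is separate, since `hq.pderiv` then has the truncated degree 0 − 1 = 0; there `q` is
  -- constant and both sides vanish.
  cases d with
  | zero =>
    rw [← MvPolynomial.totalDegree_zero_iff_isHomogeneous,
      MvPolynomial.totalDegree_eq_zero_iff_eq_C] at hq
    rw [hq, MvPolynomial.pderiv_C, map_zero, zero_mul, ← hq] at h
    have := (mul_eq_zero.1 h).resolve_right (by exact_mod_cast (radialMoment_pos _).ne')
    rw [this, hq]
    simp
  | succ d =>
    -- The two polynomials have degrees d + 2 and d, so their radial moments differ by the factor d
    -- + 3 = (d + 1) + 2.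
    have h2 : 1 + (d + 1) = d + 2 := by ring
    rw [h2, radialMoment_add_two, Nat.add_sub_cancel] at h
    have h0 : (radialMoment d : ℂ) ≠ 0 := by exact_mod_cast (radialMoment_pos _).ne'
    apply mul_right_cancel₀ h0
    rw [← h]
    push_cast
    ring

theorem sphereIntegral_one : sphereIntegral 1 = 4 * Real.pi := by
  rw [sphereIntegral_apply]
  have h : surfaceMeasure.real Set.univ = 4 * Real.pi := by
    rw [surfaceMeasure, MeasureTheory.Measure.toSphere_real_apply_univ, MeasureTheory.measureReal_def,
      EuclideanSpace.volume_ball_fin_three]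
    simp
    rw [ENNReal.toReal_ofReal (by positivity)]
    ring
  simp [evalReal, h]

/-! ### Funk–Hecke for powers of the inner product. -/

/-- The linear form `y ↦ ⟨x, y⟩`. -/
def linearForm (x : EuclideanSpace ℝ (Fin 3)) : MvPolynomial (Fin 3) ℂ :=
  ∑ i, MvPolynomial.C ((x i : ℝ) : ℂ) * MvPolynomial.X i

/-- The derivative in the direction `x`. -/
def dirDeriv (x : EuclideanSpace ℝ (Fin 3)) :
    Derivation ℂ (MvPolynomial (Fin 3) ℂ) (MvPolynomial (Fin 3) ℂ) :=
  ∑ i, ((x i : ℝ) : ℂ) • MvPolynomial.pderiv i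

theorem dirDeriv_apply (x : EuclideanSpace ℝ (Fin 3)) (q : MvPolynomial (Fin 3) ℂ) :
    dirDeriv x q = ∑ i, ((x i : ℝ) : ℂ) • MvPolynomial.pderiv i q := by
  simp [dirDeriv, Fin.sum_univ_three]

theorem evalReal_linearForm (x y : EuclideanSpace ℝ (Fin 3)) :
    evalReal (linearForm x) y = ((inner ℝ x y : ℝ) : ℂ) := by
  simp [evalReal, linearForm, Fin.sum_univ_three, PiLp.inner_apply]
  ring

theorem isHomogeneous_linearForm (x : EuclideanSpace ℝ (Fin 3)) : (linearForm x).IsHomogeneous 1 := by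
  refine MvPolynomial.IsHomogeneous.sum _ _ _ fun i _ => ?_
  simpa using (MvPolynomial.isHomogeneous_C (Fin 3) ((x i : ℝ) : ℂ)).mul
    (MvPolynomial.isHomogeneous_X ℂ i)

theorem dirDeriv_linearForm {x : EuclideanSpace ℝ (Fin 3)} (hx : ‖x‖ = 1) :
    dirDeriv x (linearForm x) = 1 := by
  have h : (∑ i, ((x i : ℝ) : ℂ) * ((x i : ℝ) : ℂ)) = 1 := by
    have := EuclideanSpace.real_norm_sq_eq x
    rw [hx] at this
    have h2 : ((∑ i, x i ^ 2 : ℝ) : ℂ) = 1 := by rw [← this]; simp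
    push_cast at h2
    simpa [sq] using h2
  rw [dirDeriv_apply]
  have : ∀ i, MvPolynomial.pderiv i (linearForm x) = MvPolynomial.C ((x i : ℝ) : ℂ) := by
    intro i
    simp [linearForm, MvPolynomial.pderiv_X, Pi.single_apply]
  simp_rw [this, MvPolynomial.smul_eq_C_mul, ← MvPolynomial.C_mul]
  rw [← map_sum, h, MvPolynomial.C_1]

theorem sphereIntegral_linearForm_mul {q : MvPolynomial (Fin 3) ℂ} {d : ℕ}
    (hq : q.IsHomogeneous d) (x : EuclideanSpace ℝ (Fin 3)) :
    ((d : ℂ) + 2) * sphereIntegral (linearForm x * q) = sphereIntegral (dirDeriv x q) := by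
  rw [dirDeriv_apply, linearForm, Finset.sum_mul, map_sum, map_sum, Finset.mul_sum]
  refine Finset.sum_congr rfl fun i _ => ?_
  rw [mul_assoc, ← MvPolynomial.smul_eq_C_mul, map_smul, map_smul, ← sphereIntegral_X_mul hq]
  simp only [smul_eq_mul]
  ring

/-- The commutator of two derivations is a derivation, and this one kills the variables. -/
theorem MvPolynomial.pderiv_pderiv_comm (i j : Fin 3) (p : MvPolynomial (Fin 3) ℂ) :
    MvPolynomial.pderiv i (MvPolynomial.pderiv j p) =
      MvPolynomial.pderiv j (MvPolynomial.pderiv i p) := by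
  have h : ⁅(MvPolynomial.pderiv i : Derivation ℂ (MvPolynomial (Fin 3) ℂ) (MvPolynomial (Fin 3) ℂ)),
      MvPolynomial.pderiv (R := ℂ) j⁆ = 0 := by
    apply MvPolynomial.derivation_ext
    intro l
    simp [Derivation.commutator_apply, MvPolynomial.pderiv_X, Pi.single_apply, apply_ite]
  have := DFunLike.congr_fun h p
  rw [Derivation.commutator_apply] at this
  exact sub_eq_zero.1 this

/-- The Laplacian of a polynomial. -/
def polyLaplacian (p : MvPolynomial (Fin 3) ℂ) : MvPolynomial (Fin 3) ℂ :=
  ∑ i : Fin 3, MvPolynomial.pderiv i (MvPolynomial.pderiv i p)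

theorem polyLaplacian_dirDeriv {p : MvPolynomial (Fin 3) ℂ} (hp : polyLaplacian p = 0)
    (x : EuclideanSpace ℝ (Fin 3)) : polyLaplacian (dirDeriv x p) = 0 := by
  have h : polyLaplacian (dirDeriv x p) = dirDeriv x (polyLaplacian p) := by
    simp only [polyLaplacian, dirDeriv_apply, map_sum, Derivation.map_smul]
    refine Finset.sum_congr rfl fun i _ => Finset.sum_congr rfl fun j _ => ?_
    rw [MvPolynomial.pderiv_pderiv_comm i j, MvPolynomial.pderiv_pderiv_comm i j]
  rw [h, hp, map_zero]

theorem isHomogeneous_dirDeriv {p : MvPolynomial (Fin 3) ℂ} {n : ℕ} (hp : p.IsHomogeneous n)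
    (x : EuclideanSpace ℝ (Fin 3)) : (dirDeriv x p).IsHomogeneous (n - 1) := by
  rw [dirDeriv_apply]
  refine MvPolynomial.IsHomogeneous.sum _ _ _ fun i _ => ?_
  rw [MvPolynomial.smul_eq_C_mul]
  simpa using (MvPolynomial.isHomogeneous_C (Fin 3) ((x i : ℝ) : ℂ)).mul hp.pderiv

theorem evalReal_dirDeriv_self {p : MvPolynomial (Fin 3) ℂ} {n : ℕ} (hp : p.IsHomogeneous n)
    (x : EuclideanSpace ℝ (Fin 3)) : evalReal (dirDeriv x p) x = n * evalReal p x := by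
  have h := congrArg (fun q => evalReal q x) hp.sum_X_mul_pderiv
  simp only [evalReal, map_sum, map_mul, MvPolynomial.eval_X, nsmul_eq_mul, map_natCast] at h
  rw [dirDeriv_apply, evalReal, evalReal, ← h, map_sum]
  exact Finset.sum_congr rfl fun i _ => MvPolynomial.smul_eval _ _ _

/-- Euler's identity writes (n + 1)p as ∑ X_i ∂_i p, and the divergence identity turns its integral
into a multiple of that of the Laplacian. -/
theorem sphereIntegral_eq_zero {p : MvPolynomial (Fin 3) ℂ} {n : ℕ}
    (hp : p.IsHomogeneous (n + 1)) (hL : polyLaplacian p = 0) : sphereIntegral p = 0 := by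
  have h := congrArg sphereIntegral hp.sum_X_mul_pderiv
  rw [map_sum, map_nsmul] at h
  have h2 : ((n : ℂ) + 2) * ∑ i, sphereIntegral (MvPolynomial.X i * MvPolynomial.pderiv i p) = 0 := by
    rw [Finset.mul_sum]
    have : ∀ i : Fin 3, ((n : ℂ) + 2) * sphereIntegral (MvPolynomial.X i * MvPolynomial.pderiv i p) =
        sphereIntegral (MvPolynomial.pderiv i (MvPolynomial.pderiv i p)) := fun i =>
      sphereIntegral_X_mul (by simpa using hp.pderiv) i
    simp_rw [this]
    rw [← map_sum]
    exact (congrArg sphereIntegral hL).trans (map_zero _)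
  rw [h, nsmul_eq_mul] at h2
  have h3 : ((n : ℂ) + 2) ≠ 0 := by exact_mod_cast (show n + 2 ≠ 0 by omega)
  have h4 : (((n + 1 : ℕ)) : ℂ) ≠ 0 := by exact_mod_cast (show n + 1 ≠ 0 by omega)
  exact (mul_eq_zero.1 ((mul_eq_zero.1 h2).resolve_left h3)).resolve_left h4

/-- The Funk-Hecke formula for powers. -/
theorem sphereIntegral_linearForm_pow_mul {x : EuclideanSpace ℝ (Fin 3)} (hx : ‖x‖ = 1) (m : ℕ) :
    ∀ {n : ℕ} {p : MvPolynomial (Fin 3) ℂ}, p.IsHomogeneous n → polyLaplacian p = 0 →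
      sphereIntegral (linearForm x ^ m * p) =
        2 * Real.pi * (legendreMoment m n : ℂ) * evalReal p x := by
  induction m using Nat.strong_induction_on with
  | _ m ih =>
    intro n p hp hL
    cases m with
    | zero =>
      rw [pow_zero, one_mul]
      cases n with
      | zero =>
        rw [← MvPolynomial.totalDegree_zero_iff_isHomogeneous,
          MvPolynomial.totalDegree_eq_zero_iff_eq_C] at hp
        rw [hp, legendreMoment_zero_zero]
        have : (MvPolynomial.C (MvPolynomial.coeff 0 p) : MvPolynomial (Fin 3) ℂ) =
          MvPolynomial.coeff 0 p • 1 := by simp [MvPolynomial.smul_eq_C_mul]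
        rw [this, map_smul, sphereIntegral_one]
        simp [evalReal]
        ring
      | succ n =>
        rw [sphereIntegral_eq_zero hp hL, legendreMoment_zero_succ]
        simp
    | succ m =>
      -- The divergence identity in direction `x` splits by Leibniz into m⟨x,·⟩^{m−1}p and ⟨x,·⟩^m
      -- ∂_x p. As ∂_x p is harmonic of degree n − 1 with value n p(x) at `x`, this is the recursion
      -- `legendreMoment_succ`.
      have hh : (linearForm x ^ m * p).IsHomogeneous (m + n) := by
        simpa using ((isHomogeneous_linearForm x).pow m).mul hp
      have h := sphereIntegral_linearForm_mul hh x
      rw [Derivation.leibniz, Derivation.leibniz_pow, dirDeriv_linearForm hx, map_add] at h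
      have h1 := ih m (by omega) (isHomogeneous_dirDeriv hp x) (polyLaplacian_dirDeriv hL x)
      have h2 := ih (m - 1) (by omega) hp hL
      have h3 : p • (m • linearForm x ^ (m - 1) • (1 : MvPolynomial (Fin 3) ℂ)) =
          m • (linearForm x ^ (m - 1) * p) := by
        simp only [smul_eq_mul, nsmul_eq_mul]
        ring
      rw [smul_eq_mul, h1, h3, map_nsmul, h2, evalReal_dirDeriv_self hp, ← mul_assoc,
        ← pow_succ', nsmul_eq_mul] at h
      have hr := congrArg (fun t : ℝ => (t : ℂ)) (legendreMoment_succ m n)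
      push_cast at hr h
      have h0 : ((m : ℂ) + n + 2) ≠ 0 := by exact_mod_cast (show m + n + 2 ≠ 0 by omega)
      apply mul_left_cancel₀ h0
      linear_combination h - 2 * Real.pi * evalReal p x * hr

/-! ### Approximation by polynomials. -/

/-- Finite measures on a compact interval are determined by their moments. -/
theorem MeasureTheory.Measure.eq_of_moments_eq {μ ν : MeasureTheory.Measure ℝ}
    [MeasureTheory.IsFiniteMeasure μ] [MeasureTheory.IsFiniteMeasure ν] {a b : ℝ}
    (hμ : ∀ᵐ t ∂μ, t ∈ Set.Icc a b) (hν : ∀ᵐ t ∂ν, t ∈ Set.Icc a b)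
    (h : ∀ m : ℕ, ∫ t, t ^ m ∂μ = ∫ t, t ^ m ∂ν) : μ = ν := by
  have hint : ∀ (ρ : MeasureTheory.Measure ℝ) [MeasureTheory.IsFiniteMeasure ρ],
      (∀ᵐ t ∂ρ, t ∈ Set.Icc a b) → ∀ f : ℝ → ℝ, Continuous f → MeasureTheory.Integrable f ρ := by
    intro ρ _ hρ f hf
    obtain ⟨C, hC⟩ := isCompact_Icc.exists_bound_of_continuousOn (s := Set.Icc a b) hf.continuousOn
    exact MeasureTheory.Integrable.of_bound hf.aestronglyMeasurable C (hρ.mono hC)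
  have hpoly : ∀ q : Polynomial ℝ, ∫ t, q.eval t ∂μ = ∫ t, q.eval t ∂ν := by
    intro q
    induction q using Polynomial.induction_on' with
    | add p q hp hq =>
      simp_rw [Polynomial.eval_add]
      rw [MeasureTheory.integral_add (hint μ hμ _ p.continuous) (hint μ hμ _ q.continuous),
        MeasureTheory.integral_add (hint ν hν _ p.continuous) (hint ν hν _ q.continuous), hp, hq]
    | monomial m c =>
      simp_rw [Polynomial.eval_monomial, MeasureTheory.integral_const_mul, h]
  refine MeasureTheory.ext_of_forall_integral_eq_of_IsFiniteMeasure fun f => ?_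
  have hclose : ∀ (ρ : MeasureTheory.Measure ℝ) [MeasureTheory.IsFiniteMeasure ρ],
      (∀ᵐ t ∂ρ, t ∈ Set.Icc a b) → ∀ (q : Polynomial ℝ) (ε : ℝ),
      (∀ t ∈ Set.Icc a b, |q.eval t - f t| < ε) →
      |∫ t, q.eval t ∂ρ - ∫ t, f t ∂ρ| ≤ ε * ρ.real Set.univ := by
    intro ρ _ hρ q ε hq
    rw [← MeasureTheory.integral_sub (hint ρ hρ _ q.continuous) (hint ρ hρ _ f.continuous)]
    exact MeasureTheory.norm_integral_le_of_norm_le_const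
      (f := fun t => q.eval t - f t) (hρ.mono fun t ht => (hq t ht).le)
  refine eq_of_abs_sub_nonpos (le_of_forall_pos_le_add fun δ hδ => ?_)
  set M := μ.real Set.univ + ν.real Set.univ with hM
  have hM0 : 0 ≤ M := by positivity
  -- This tolerance makes the errors under both measures add up to at most δ; the 1 covers M = 0.
  obtain ⟨q, hq⟩ := exists_polynomial_near_of_continuousOn a b f f.continuous.continuousOn
    (δ / (M + 1)) (by positivity)
  have h1 := hclose μ hμ q _ hq
  have h2 := hclose ν hν q _ hq
  rw [hpoly q] at h1
  have h3 : δ / (M + 1) * M ≤ δ := by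
    rw [div_mul_eq_mul_div, div_le_iff₀ (by positivity)]
    nlinarith
  rw [hM, mul_add] at h3
  rw [abs_le] at h1 h2 ⊢
  constructor <;> linarith [h1.1, h1.2, h2.1, h2.2]

/-- Polynomials are dense in `L¹` of an interval. -/
theorem exists_polynomial_integral_norm_sub_le {a b : ℝ} {g : ℝ → ℂ}
    (hg : MeasureTheory.IntegrableOn g (Set.Ioc a b)) {δ : ℝ} (hδ : 0 < δ) :
    ∃ q : Polynomial ℂ, ∫ t in Set.Ioc a b, ‖g t - q.eval (t : ℂ)‖ ≤ δ := by
  obtain ⟨f, -, hgf, hf, hfi⟩ :=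
    MeasureTheory.Integrable.exists_hasCompactSupport_integral_sub_le hg (half_pos hδ)
  set ν := MeasureTheory.volume.restrict (Set.Ioc a b) with hν
  set M := ν.real Set.univ
  have hM0 : 0 ≤ M := by positivity
  -- Real and imaginary parts each cost ε, so this stage contributes at most 2εM ≤ δ/2.
  set ε := δ / (4 * (M + 1))
  have hε : 0 < ε := by positivity
  obtain ⟨q₁, hq₁⟩ := exists_polynomial_near_of_continuousOn a b (fun t => (f t).re)
    (Complex.continuous_re.comp hf).continuousOn ε hε
  obtain ⟨q₂, hq₂⟩ := exists_polynomial_near_of_continuousOn a b (fun t => (f t).im)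
    (Complex.continuous_im.comp hf).continuousOn ε hε
  set q : Polynomial ℂ := q₁.map (algebraMap ℝ ℂ) +
    Polynomial.C Complex.I * q₂.map (algebraMap ℝ ℂ) with hq
  have he : ∀ t : ℝ, q.eval (t : ℂ) = ((q₁.eval t : ℝ) : ℂ) + Complex.I * ((q₂.eval t : ℝ) : ℂ) := by
    intro t
    have hm : ∀ r : Polynomial ℝ, (r.map (algebraMap ℝ ℂ)).eval (t : ℂ) = ((r.eval t : ℝ) : ℂ) :=
      fun r => Polynomial.eval_map_apply (algebraMap ℝ ℂ) t
    rw [hq, Polynomial.eval_add, Polynomial.eval_mul, Polynomial.eval_C, hm, hm]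
  have hb : ∀ᵐ t ∂ν, ‖f t - q.eval (t : ℂ)‖ ≤ 2 * ε := by
    refine (MeasureTheory.ae_restrict_mem measurableSet_Ioc).mono fun t ht => ?_
    have ht' := Set.Ioc_subset_Icc_self ht
    refine (Complex.norm_le_abs_re_add_abs_im _).trans ?_
    have h1 := (hq₁ t ht').le
    have h2 := (hq₂ t ht').le
    rw [abs_sub_comm] at h1 h2
    rw [he]
    simp
    linarith
  have hqc : Continuous fun t : ℝ => q.eval (t : ℂ) := q.continuous.comp Complex.continuous_ofReal
  have hfq : MeasureTheory.Integrable (fun t => ‖f t - q.eval (t : ℂ)‖) ν :=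
    MeasureTheory.Integrable.of_bound (hf.sub hqc).norm.aestronglyMeasurable (2 * ε)
      (hb.mono fun t ht => by rwa [norm_norm])
  have hgf' : MeasureTheory.Integrable (fun t => ‖g t - f t‖) ν := (hg.sub hfi).norm
  refine ⟨q, ?_⟩
  have h1 : ∫ t, ‖g t - q.eval (t : ℂ)‖ ∂ν ≤
      ∫ t, (‖g t - f t‖ + ‖f t - q.eval (t : ℂ)‖) ∂ν := by
    refine MeasureTheory.integral_mono_of_nonneg (Filter.Eventually.of_forall fun t => norm_nonneg _)
      (hgf'.add hfq) (Filter.Eventually.of_forall fun t => norm_sub_le_norm_sub_add_norm_sub _ _ _)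
  rw [MeasureTheory.integral_add hgf' hfq] at h1
  have h2 : ∫ t, ‖f t - q.eval (t : ℂ)‖ ∂ν ≤ 2 * ε * M := by
    have := MeasureTheory.norm_integral_le_of_norm_le_const (μ := ν)
      (f := fun t => ‖f t - q.eval (t : ℂ)‖) (C := 2 * ε) (hb.mono fun t ht => by rwa [norm_norm])
    exact (le_abs_self _).trans this
  have h3 : 2 * ε * M ≤ δ / 2 := by
    have : 2 * ε * M = δ / 2 * (M / (M + 1)) := by
      simp only [ε]
      field_simp
      ring
    rw [this]
    have h4 : M / (M + 1) ≤ 1 := by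
      rw [div_le_one (by positivity)]
      linarith
    nlinarith
  linarith

/-! ### Funk–Hecke for integrable profiles. -/

/-- The height of a point of the sphere above the equator orthogonal to `x`. -/
def sphereHeight (x y : UnitSphere3) : ℝ :=
  inner ℝ (x : EuclideanSpace ℝ (Fin 3)) (y : EuclideanSpace ℝ (Fin 3))

theorem continuous_sphereHeight (x : UnitSphere3) : Continuous (sphereHeight x) := by
  unfold sphereHeight
  fun_prop

theorem UnitSphere3.norm_eq (x : UnitSphere3) : ‖(x : EuclideanSpace ℝ (Fin 3))‖ = 1 := by
  simp

theorem sphereHeight_mem_Icc (x y : UnitSphere3) : sphereHeight x y ∈ Set.Icc (-1 : ℝ) 1 := by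
  have := abs_real_inner_le_norm (x : EuclideanSpace ℝ (Fin 3)) (y : EuclideanSpace ℝ (Fin 3))
  rw [UnitSphere3.norm_eq, UnitSphere3.norm_eq, one_mul, abs_le] at this
  exact this

theorem funk_hecke_polynomial (x : UnitSphere3) {p : MvPolynomial (Fin 3) ℂ} {n : ℕ}
    (hp : p.IsHomogeneous n) (hL : polyLaplacian p = 0) (q : Polynomial ℂ) :
    ∫ y, q.eval (sphereHeight x y : ℂ) * evalReal p y ∂surfaceMeasure =
      2 * Real.pi * (∫ t in (-1 : ℝ)..1, q.eval (t : ℂ) * (((legendreP n).eval t : ℝ) : ℂ)) *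
        evalReal p x := by
  have hT := continuous_sphereHeight x
  have hpc := continuous_evalReal_sphere p
  have hP : Continuous fun t : ℝ => (((legendreP n).eval t : ℝ) : ℂ) := by fun_prop
  have hqT : ∀ r : Polynomial ℂ, Continuous fun y => r.eval (sphereHeight x y : ℂ) :=
    fun r => r.continuous.comp (Complex.continuous_ofReal.comp hT)
  have hqc : ∀ r : Polynomial ℂ, Continuous fun t : ℝ => r.eval (t : ℂ) :=
    fun r => r.continuous.comp Complex.continuous_ofReal
  have hmul : ∀ r : Polynomial ℂ,
      Continuous fun y : UnitSphere3 => r.eval (sphereHeight x y : ℂ) * evalReal p y :=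
    fun r => (hqT r).mul hpc
  have hmul' : ∀ r : Polynomial ℂ,
      Continuous fun t : ℝ => r.eval (t : ℂ) * (((legendreP n).eval t : ℝ) : ℂ) :=
    fun r => (hqc r).mul hP
  induction q using Polynomial.induction_on' with
  | add r s hr hs =>
    simp_rw [Polynomial.eval_add, add_mul]
    rw [MeasureTheory.integral_add (integrable_surfaceMeasure_of_continuous (hmul r))
      (integrable_surfaceMeasure_of_continuous (hmul s)), hr, hs,
      intervalIntegral.integral_add ((hmul' r).intervalIntegrable _ _)
        ((hmul' s).intervalIntegrable _ _)]
    ring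
  | monomial m c =>
    simp_rw [Polynomial.eval_monomial, mul_assoc]
    rw [MeasureTheory.integral_const_mul, intervalIntegral.integral_const_mul]
    have h := sphereIntegral_linearForm_pow_mul (UnitSphere3.norm_eq x) m hp hL
    rw [sphereIntegral_apply] at h
    have h1 : ∀ y : UnitSphere3, evalReal (linearForm x ^ m * p) y =
        (sphereHeight x y : ℂ) ^ m * evalReal p y := by
      intro y
      rw [sphereHeight, ← evalReal_linearForm]
      simp [evalReal]
    have h2 : ∫ t in (-1 : ℝ)..1, (t : ℂ) ^ m * (((legendreP n).eval t : ℝ) : ℂ) =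
        (legendreMoment m n : ℂ) := by
      rw [legendreMoment, ← intervalIntegral.integral_ofReal]
      push_cast
      rfl
    simp_rw [h1] at h
    rw [h, h2]
    ring

/-- Archimedes' theorem: the height is uniformly distributed on the sphere. -/
theorem map_sphereHeight (x : UnitSphere3) :
    surfaceMeasure.map (sphereHeight x) =
      ENNReal.ofReal (2 * Real.pi) • MeasureTheory.volume.restrict (Set.Ioc (-1 : ℝ) 1) := by
  have hT := continuous_sphereHeight x
  have : MeasureTheory.IsFiniteMeasure
      (ENNReal.ofReal (2 * Real.pi) • MeasureTheory.volume.restrict (Set.Ioc (-1 : ℝ) 1)) :=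
    MeasureTheory.Measure.smul_finite _ ENNReal.ofReal_ne_top
  refine MeasureTheory.Measure.eq_of_moments_eq (a := -1) (b := 1) ?_ ?_ fun m => ?_
  · refine (MeasureTheory.ae_map_iff (p := fun t => t ∈ Set.Icc (-1 : ℝ) 1) hT.aemeasurable
      measurableSet_Icc).2 ?_
    exact Filter.Eventually.of_forall (sphereHeight_mem_Icc x)
  · refine MeasureTheory.Measure.ae_smul_measure ?_ _
    exact (MeasureTheory.ae_restrict_mem measurableSet_Ioc).mono fun t ht =>
      Set.Ioc_subset_Icc_self ht
  · rw [MeasureTheory.integral_map hT.aemeasurable (by fun_prop),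
      MeasureTheory.integral_smul_measure, ENNReal.toReal_ofReal (by positivity), smul_eq_mul,
      ← intervalIntegral.integral_of_le (by norm_num)]
    -- The moments of the height are the case p = 1, n = 0, where P_0 = 1.
    have h := funk_hecke_polynomial x (MvPolynomial.isHomogeneous_one (Fin 3) ℂ)
      (by simp [polyLaplacian]) (Polynomial.X ^ m)
    simp only [Polynomial.eval_pow, Polynomial.eval_X, legendreP_zero, Polynomial.eval_one,
      evalReal, map_one, Complex.ofReal_one, mul_one] at h
    have h1 : ∫ t in (-1 : ℝ)..1, (t : ℂ) ^ m = ((∫ t in (-1 : ℝ)..1, t ^ m : ℝ) : ℂ) := by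
      rw [← intervalIntegral.integral_ofReal]
      push_cast
      rfl
    have h2 : ∫ y, (sphereHeight x y : ℂ) ^ m ∂surfaceMeasure =
        ((∫ y, sphereHeight x y ^ m ∂surfaceMeasure : ℝ) : ℂ) := by
      rw [← integral_complex_ofReal]
      push_cast
      rfl
    rw [h1, h2] at h
    exact_mod_cast h

theorem integrable_comp_sphereHeight (x : UnitSphere3) {g : ℝ → ℂ}
    (hg : MeasureTheory.IntegrableOn g (Set.Ioc (-1 : ℝ) 1)) :
    MeasureTheory.Integrable (fun y => g (sphereHeight x y)) surfaceMeasure := by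
  have hg' : MeasureTheory.Integrable g (surfaceMeasure.map (sphereHeight x)) := by
    rw [map_sphereHeight]
    exact hg.smul_measure ENNReal.ofReal_ne_top
  exact hg'.comp_measurable (continuous_sphereHeight x).measurable

theorem integral_norm_comp_sphereHeight (x : UnitSphere3) {g : ℝ → ℂ}
    (hg : MeasureTheory.IntegrableOn g (Set.Ioc (-1 : ℝ) 1)) :
    ∫ y, ‖g (sphereHeight x y)‖ ∂surfaceMeasure =
      2 * Real.pi * ∫ t in Set.Ioc (-1 : ℝ) 1, ‖g t‖ := by
  have hg' : MeasureTheory.Integrable g (surfaceMeasure.map (sphereHeight x)) := by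
    rw [map_sphereHeight]
    exact hg.smul_measure ENNReal.ofReal_ne_top
  rw [← MeasureTheory.integral_map (f := fun t => ‖g t‖)
    (continuous_sphereHeight x).aemeasurable hg'.norm.aestronglyMeasurable,
    map_sphereHeight, MeasureTheory.integral_smul_measure,
    ENNReal.toReal_ofReal (by positivity), smul_eq_mul]

theorem exists_norm_evalReal_le (p : MvPolynomial (Fin 3) ℂ) :
    ∃ C : ℝ, 0 ≤ C ∧ ∀ y : UnitSphere3, ‖evalReal p y‖ ≤ C := by
  obtain ⟨C, hC⟩ := isCompact_univ.exists_bound_of_continuousOn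
    (continuous_evalReal_sphere p).continuousOn
  exact ⟨max C 0, le_max_right _ _, fun y => (hC y (Set.mem_univ y)).trans (le_max_left _ _)⟩

theorem integrable_comp_sphereHeight_mul (x : UnitSphere3) (p : MvPolynomial (Fin 3) ℂ) {g : ℝ → ℂ}
    (hg : MeasureTheory.IntegrableOn g (Set.Ioc (-1 : ℝ) 1)) :
    MeasureTheory.Integrable (fun y => g (sphereHeight x y) * evalReal p y) surfaceMeasure := by
  obtain ⟨C, -, hC⟩ := exists_norm_evalReal_le p
  exact (integrable_comp_sphereHeight x hg).mul_bdd
    (continuous_evalReal_sphere p).aestronglyMeasurable (Filter.Eventually.of_forall hC)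

/-- The Funk-Hecke formula. -/
theorem funk_hecke (x : UnitSphere3) {p : MvPolynomial (Fin 3) ℂ} {n : ℕ}
    (hp : p.IsHomogeneous n) (hL : polyLaplacian p = 0) {g : ℝ → ℂ}
    (hg : MeasureTheory.IntegrableOn g (Set.Ioc (-1 : ℝ) 1)) :
    ∫ y, g (sphereHeight x y) * evalReal p y ∂surfaceMeasure =
      2 * Real.pi * (∫ t in (-1 : ℝ)..1, g t * (((legendreP n).eval t : ℝ) : ℂ)) *
        evalReal p x := by
  obtain ⟨C, hC0, hC⟩ := exists_norm_evalReal_le p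
  have hPc : Continuous fun t : ℝ => (((legendreP n).eval t : ℝ) : ℂ) := by fun_prop
  obtain ⟨D, hD⟩ := isCompact_Icc.exists_bound_of_continuousOn (s := Set.Icc (-1 : ℝ) 1)
    hPc.continuousOn
  have hD0 : 0 ≤ D := (norm_nonneg _).trans (hD 0 (by norm_num))
  refine eq_of_norm_sub_le_zero (le_of_forall_pos_le_add fun δ hδ => ?_)
  -- Replacing g by q costs 2πC‖g − q‖₁ on the sphere side and 2πCD‖g − q‖₁ on the interval side.
  set M := 2 * Real.pi * (C + D * C) with hM
  have hM0 : 0 ≤ M := by positivity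
  obtain ⟨q, hq⟩ := exists_polynomial_integral_norm_sub_le hg
    (δ := δ / (M + 1)) (by positivity)
  have hqi : MeasureTheory.IntegrableOn (fun t : ℝ => q.eval (t : ℂ)) (Set.Ioc (-1 : ℝ) 1) :=
    ((q.continuous.comp Complex.continuous_ofReal).integrableOn_Icc).mono_set
      Set.Ioc_subset_Icc_self
  have hgq := hg.sub hqi
  have hmul : ∀ f : ℝ → ℂ, MeasureTheory.IntegrableOn f (Set.Ioc (-1 : ℝ) 1) →
      MeasureTheory.IntegrableOn (fun t => f t * (((legendreP n).eval t : ℝ) : ℂ))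
        (Set.Ioc (-1 : ℝ) 1) := by
    intro f hf
    refine MeasureTheory.Integrable.mul_bdd (c := D) hf hPc.aestronglyMeasurable ?_
    exact (MeasureTheory.ae_restrict_mem measurableSet_Ioc).mono fun t ht =>
      hD t (Set.Ioc_subset_Icc_self ht)
  have h1 : ‖∫ y, (g (sphereHeight x y) - q.eval (sphereHeight x y : ℂ)) * evalReal p y
      ∂surfaceMeasure‖ ≤ 2 * Real.pi * C * (δ / (M + 1)) := by
    have hb := MeasureTheory.norm_integral_le_of_norm_le
      (f := fun y => (g (sphereHeight x y) - q.eval (sphereHeight x y : ℂ)) * evalReal p y)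
      (((integrable_comp_sphereHeight x hgq).norm).mul_const C)
      (Filter.Eventually.of_forall fun y => by
        rw [norm_mul]
        exact mul_le_mul_of_nonneg_left (hC y) (norm_nonneg _))
    rw [MeasureTheory.integral_mul_const, integral_norm_comp_sphereHeight x hgq] at hb
    refine hb.trans ?_
    have : 0 ≤ 2 * Real.pi * C := by positivity
    calc _ = 2 * Real.pi * C * ∫ t in Set.Ioc (-1 : ℝ) 1, ‖g t - q.eval (t : ℂ)‖ := by
          simp only [Pi.sub_apply]
          ring
      _ ≤ _ := mul_le_mul_of_nonneg_left hq this
  have h2 : ‖∫ t in (-1 : ℝ)..1, (g t - q.eval (t : ℂ)) * (((legendreP n).eval t : ℝ) : ℂ)‖ ≤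
      D * (δ / (M + 1)) := by
    rw [intervalIntegral.integral_of_le (by norm_num)]
    have hb := MeasureTheory.norm_integral_le_of_norm_le
      (f := fun t => (g t - q.eval (t : ℂ)) * (((legendreP n).eval t : ℝ) : ℂ))
      (hgq.norm.mul_const D)
      ((MeasureTheory.ae_restrict_mem measurableSet_Ioc).mono fun t ht => by
        rw [norm_mul]
        exact mul_le_mul_of_nonneg_left (hD t (Set.Ioc_subset_Icc_self ht)) (norm_nonneg _))
    rw [MeasureTheory.integral_mul_const, mul_comm] at hb
    exact hb.trans (mul_le_mul_of_nonneg_left hq hD0)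
  have h3 := funk_hecke_polynomial x hp hL q
  simp_rw [sub_mul] at h1 h2
  rw [MeasureTheory.integral_sub (integrable_comp_sphereHeight_mul x p hg)
    (integrable_comp_sphereHeight_mul x p hqi), h3] at h1
  rw [intervalIntegral.integral_sub
    ((intervalIntegrable_iff_integrableOn_Ioc_of_le (by norm_num)).2 (hmul g hg))
    ((intervalIntegrable_iff_integrableOn_Ioc_of_le (by norm_num)).2 (hmul _ hqi))] at h2
  set A := ∫ y, g (sphereHeight x y) * evalReal p y ∂surfaceMeasure
  set B := ∫ t in (-1 : ℝ)..1, g t * (((legendreP n).eval t : ℝ) : ℂ)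
  set Q := ∫ t in (-1 : ℝ)..1, q.eval (t : ℂ) * (((legendreP n).eval t : ℝ) : ℂ)
  have h4 : A - 2 * Real.pi * B * evalReal p x =
      (A - 2 * Real.pi * Q * evalReal p x) - 2 * Real.pi * evalReal p x * (B - Q) := by ring
  have h5 : ‖(2 : ℂ) * Real.pi * evalReal p x * (B - Q)‖ ≤
      2 * Real.pi * C * (D * (δ / (M + 1))) := by
    rw [norm_mul, norm_mul, norm_mul, Complex.norm_real, Real.norm_of_nonneg Real.pi_pos.le,
      Complex.norm_ofNat]
    gcongr
    exact hC x
  rw [h4, zero_add]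
  refine (norm_sub_le _ _).trans ((add_le_add h1 h5).trans ?_)
  calc _ = δ * (M / (M + 1)) := by rw [hM]; ring
    _ ≤ δ * 1 := by
      gcongr
      rw [div_le_one (by positivity)]
      linarith
    _ = δ := mul_one δ

/-! ### The kernel as a function of the inner product. -/

/-- The distance of two points of the unit sphere whose inner product is `t`. -/
def chord (t : ℝ) : ℝ := Real.sqrt (2 * (1 - t))

theorem continuous_chord : Continuous chord := by
  unfold chord
  fun_prop

theorem chord_nonneg (t : ℝ) : 0 ≤ chord t := Real.sqrt_nonneg _

theorem chord_one : chord 1 = 0 := by simp [chord]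

theorem chord_pos {t : ℝ} (ht : t < 1) : 0 < chord t := Real.sqrt_pos.2 (by linarith)

theorem chord_sq {t : ℝ} (ht : t ≤ 1) : chord t ^ 2 = 2 * (1 - t) := Real.sq_sqrt (by linarith)

theorem hasDerivAt_chord {t : ℝ} (ht : t < 1) : HasDerivAt chord (-(chord t)⁻¹) t := by
  have h : HasDerivAt (fun t : ℝ => 2 * (1 - t)) (-2) t := by
    refine (((hasDerivAt_id t).const_sub 1).const_mul 2).congr_deriv ?_
    norm_num
  refine (h.sqrt (by linarith)).congr_deriv ?_
  have := chord_pos ht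
  change -2 / (2 * chord t) = _
  field_simp

theorem dist_eq_chord (x y : UnitSphere3) : dist x y = chord (sphereHeight x y) := by
  have h : dist x y ^ 2 = 2 * (1 - sphereHeight x y) := by
    rw [Subtype.dist_eq, dist_eq_norm, norm_sub_sq_real, UnitSphere3.norm_eq, UnitSphere3.norm_eq,
      sphereHeight]
    ring
  rw [chord, ← h, Real.sqrt_sq dist_nonneg]

/-- The spherical wave `exp (i k r)` as a function of the inner product. -/
def chordWave (k t : ℝ) : ℂ := Complex.exp (Complex.I * (k : ℂ) * ((chord t : ℝ) : ℂ))

theorem continuous_chordWave (k : ℝ) : Continuous (chordWave k) := by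
  have := continuous_chord
  unfold chordWave
  fun_prop

/-- The kernel of the Neumann-Poincaré operator as a function of the inner product. -/
def npProfile (k t : ℝ) : ℂ :=
  (1 - Complex.I * (k : ℂ) * ((chord t : ℝ) : ℂ)) * chordWave k t / (8 * Real.pi * (chord t : ℂ))

theorem hasLineDerivAt_helmholtzG (k : ℝ) {z : EuclideanSpace ℝ (Fin 3)} (hz : z ≠ 0)
    (v : EuclideanSpace ℝ (Fin 3)) :
    HasLineDerivAt ℝ (helmholtzG k)
      ((1 - Complex.I * (k : ℂ) * (‖z‖ : ℂ)) * Complex.exp (Complex.I * (k : ℂ) * (‖z‖ : ℂ)) *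
        ((inner ℝ z v : ℝ) : ℂ) / (4 * Real.pi * (‖z‖ : ℂ) ^ 3)) z v := by
  have hz' : ‖z‖ ≠ 0 := norm_ne_zero_iff.2 hz
  have hzc : (‖z‖ : ℂ) ≠ 0 := by exact_mod_cast hz'
  unfold HasLineDerivAt
  have hn : HasDerivAt (fun s : ℝ => ‖z + s • v‖) (inner ℝ z v / ‖z‖) 0 := by
    have h1 : ∀ s : ℝ, ‖z + s • v‖ = Real.sqrt (‖z‖ ^ 2 + s * (2 * inner ℝ z v) + s ^ 2 * ‖v‖ ^ 2) := by
      intro s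
      rw [← Real.sqrt_sq (norm_nonneg (z + s • v)), norm_add_sq_real, inner_smul_right, norm_smul,
        mul_pow, Real.norm_eq_abs, sq_abs]
      ring_nf
    simp_rw [h1]
    have h2 : HasDerivAt (fun s : ℝ => ‖z‖ ^ 2 + s * (2 * inner ℝ z v) + s ^ 2 * ‖v‖ ^ 2)
        (2 * inner ℝ z v) 0 := by
      refine ((((hasDerivAt_id (0 : ℝ)).mul_const (2 * inner ℝ z v)).const_add (‖z‖ ^ 2)).fun_add
        ((hasDerivAt_pow 2 (0 : ℝ)).mul_const (‖v‖ ^ 2))).congr_deriv ?_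
      simp
    refine (h2.sqrt (by simpa using hz)).congr_deriv ?_
    simp
    field_simp
  have hc := hn.ofReal_comp
  have he := (hc.const_mul (Complex.I * (k : ℂ))).cexp
  have h4 : (4 * (Real.pi : ℂ) * ((‖z + (0 : ℝ) • v‖ : ℝ) : ℂ)) ≠ 0 := by
    simp [hz, Real.pi_ne_zero]
  have h := he.fun_neg.fun_div (hc.const_mul (4 * (Real.pi : ℂ))) h4
  refine h.congr_deriv ?_
  have hpi : (Real.pi : ℂ) ≠ 0 := by exact_mod_cast Real.pi_ne_zero
  simp only [zero_smul, add_zero]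
  push_cast
  field_simp
  ring

theorem differentiableAt_helmholtzG (k : ℝ) {z : EuclideanSpace ℝ (Fin 3)} (hz : z ≠ 0) :
    DifferentiableAt ℝ (helmholtzG k) z := by
  have hn : DifferentiableAt ℝ (fun y : EuclideanSpace ℝ (Fin 3) => ((‖y‖ : ℝ) : ℂ)) z :=
    Complex.ofRealCLM.differentiableAt.comp z (differentiableAt_id.norm ℝ hz)
  have h4 : (4 * (Real.pi : ℂ) * ((‖z‖ : ℝ) : ℂ)) ≠ 0 := by simp [hz, Real.pi_ne_zero]
  have hd := hn.const_mul (4 * (Real.pi : ℂ))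
  have he : helmholtzG k = fun y =>
      -Complex.exp (Complex.I * (k : ℂ) * ((‖y‖ : ℝ) : ℂ)) *
        (4 * (Real.pi : ℂ) * ((‖y‖ : ℝ) : ℂ))⁻¹ := funext fun y => div_eq_mul_inv _ _
  rw [he]
  exact ((hn.const_mul (Complex.I * (k : ℂ))).cexp.fun_neg).fun_mul (hd.fun_inv h4)

/-- The radial derivative brings 1/r³, and ⟨x − y, x⟩ = 1 − t = r²/2 cancels two of these powers. -/
theorem npKernel_eq_npProfile (k : ℝ) {x y : UnitSphere3} (hxy : x ≠ y) :
    npKernel k x y = npProfile k (sphereHeight x y) := by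
  have hz : (x : EuclideanSpace ℝ (Fin 3)) - (y : EuclideanSpace ℝ (Fin 3)) ≠ 0 :=
    sub_ne_zero.2 fun h => hxy (Subtype.ext h)
  rw [npKernel, ← (differentiableAt_helmholtzG k hz).lineDeriv_eq_fderiv,
    (hasLineDerivAt_helmholtzG k hz _).lineDeriv]
  have hd : ‖(x : EuclideanSpace ℝ (Fin 3)) - (y : EuclideanSpace ℝ (Fin 3))‖ =
      chord (sphereHeight x y) := by
    rw [← dist_eq_chord, Subtype.dist_eq, dist_eq_norm]
  have hi : inner ℝ ((x : EuclideanSpace ℝ (Fin 3)) - (y : EuclideanSpace ℝ (Fin 3)))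
      (x : EuclideanSpace ℝ (Fin 3)) = chord (sphereHeight x y) ^ 2 / 2 := by
    rw [chord_sq (sphereHeight_mem_Icc x y).2, inner_sub_left, real_inner_self_eq_norm_sq,
      UnitSphere3.norm_eq, real_inner_comm, sphereHeight]
    ring
  rw [hi, hd, npProfile, chordWave]
  have h0 : (chord (sphereHeight x y) : ℂ) ≠ 0 := by
    rw [← hd]
    exact_mod_cast norm_ne_zero_iff.2 hz
  have hpi : (Real.pi : ℂ) ≠ 0 := by exact_mod_cast Real.pi_ne_zero
  push_cast
  field_simp
  ring

/-- A nonnegative derivative of a function continuous up to the endpoints is integrable; here the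
primitive is −r. -/
theorem integrableOn_inv_chord :
    MeasureTheory.IntegrableOn (fun t => (chord t)⁻¹) (Set.Ioc (-1 : ℝ) 1) := by
  refine intervalIntegral.integrableOn_deriv_of_nonneg (g := fun t => -chord t)
    continuous_chord.neg.continuousOn (fun t ht => ?_) fun t _ => inv_nonneg.2 (chord_nonneg t)
  simpa using (hasDerivAt_chord ht.2).fun_neg

theorem Continuous.integrableOn_mul_inv_chord {f : ℝ → ℂ} (hf : Continuous f) :
    MeasureTheory.IntegrableOn (fun t => f t * ((chord t : ℂ))⁻¹) (Set.Ioc (-1 : ℝ) 1) := by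
  obtain ⟨C, hC⟩ := isCompact_Icc.exists_bound_of_continuousOn (s := Set.Icc (-1 : ℝ) 1)
    hf.continuousOn
  have h := integrableOn_inv_chord.ofReal (𝕜 := ℂ)
  refine MeasureTheory.Integrable.bdd_mul (c := C) ?_ hf.aestronglyMeasurable
    ((MeasureTheory.ae_restrict_mem measurableSet_Ioc).mono fun t ht =>
      hC t (Set.Ioc_subset_Icc_self ht))
  simpa using h

theorem integrableOn_npProfile (k : ℝ) :
    MeasureTheory.IntegrableOn (npProfile k) (Set.Ioc (-1 : ℝ) 1) := by
  have h1 := continuous_chord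
  have h2 := continuous_chordWave k
  have hc : Continuous fun t => (1 - Complex.I * (k : ℂ) * ((chord t : ℝ) : ℂ)) * chordWave k t /
      (8 * Real.pi) := by fun_prop
  refine (hc.integrableOn_mul_inv_chord).congr_fun (fun t _ => ?_) measurableSet_Ioc
  simp only [npProfile]
  ring

/-! ### The eigenvalue and its uniqueness. -/

/-- The eigenvalue of the Neumann-Poincaré operator on spherical harmonics of order `n`. -/
def npEigenvalue (n : ℕ) (k : ℝ) : ℂ :=
  2 * Real.pi * ∫ t in (-1 : ℝ)..1, npProfile k t * (((legendreP n).eval t : ℝ) : ℂ)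

/-- The kernel is integrable, so dominated convergence identifies the principal value with the full
integral, which Funk–Hecke evaluates. -/
theorem isNeumannPoincareImage_evalReal {n : ℕ} (k : ℝ) {p : MvPolynomial (Fin 3) ℂ}
    (hp : p.IsHomogeneous n) (hL : polyLaplacian p = 0) :
    IsNeumannPoincareImage k (fun y => evalReal p y) fun x => npEigenvalue n k * evalReal p x := by
  intro x
  simp only
  rw [npEigenvalue, ← funk_hecke x hp hL (integrableOn_npProfile k)]
  have hi := integrable_comp_sphereHeight_mul x p (integrableOn_npProfile k)
  have hms : ∀ ε : ℝ, MeasurableSet {y : UnitSphere3 | ε < dist x y} := fun ε =>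
    (isOpen_lt continuous_const (continuous_const.dist continuous_id)).measurableSet
  have hset : ∀ ε ∈ Set.Ioi (0 : ℝ),
      ∫ y in {y : UnitSphere3 | ε < dist x y}, npKernel k x y * evalReal p y ∂surfaceMeasure =
      ∫ y, {y : UnitSphere3 | ε < dist x y}.indicator
        (fun y => npProfile k (sphereHeight x y) * evalReal p y) y ∂surfaceMeasure := by
    intro ε hε
    rw [MeasureTheory.integral_indicator (hms ε)]
    refine MeasureTheory.setIntegral_congr_fun (hms ε) fun y hy => ?_
    have hxy : x ≠ y := dist_pos.1 (lt_trans hε hy)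
    simp only [npKernel_eq_npProfile k hxy]
  refine Filter.Tendsto.congr'
    (Filter.eventuallyEq_of_mem self_mem_nhdsWithin fun ε hε => (hset ε hε).symm) ?_
  refine MeasureTheory.tendsto_integral_filter_of_dominated_convergence
    (fun y => ‖npProfile k (sphereHeight x y) * evalReal p y‖)
    (Filter.Eventually.of_forall fun ε => (hi.indicator (hms ε)).aestronglyMeasurable)
    (Filter.Eventually.of_forall fun ε => Filter.Eventually.of_forall fun y =>
      norm_indicator_le_norm_self _ _) hi.norm (Filter.Eventually.of_forall fun y => ?_)
  -- At y = x division by zero gives the profile the value 0, so the cut-off integrands converge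
  -- there too.
  by_cases hxy : x = y
  · have h0 : sphereHeight x y = 1 := by
      rw [hxy, sphereHeight, real_inner_self_eq_norm_sq, UnitSphere3.norm_eq, one_pow]
    have h1 : npProfile k (sphereHeight x y) = 0 := by simp [h0, npProfile, chord_one]
    rw [h1, zero_mul]
    refine tendsto_const_nhds.congr fun ε => ?_
    by_cases hy : y ∈ {y : UnitSphere3 | ε < dist x y}
    · rw [Set.indicator_of_mem hy, h1, zero_mul]
    · rw [Set.indicator_of_notMem hy]
  · refine tendsto_const_nhds.congr' ?_
    have hpos : 0 < dist x y := dist_pos.2 hxy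
    filter_upwards [nhdsWithin_le_nhds (Iio_mem_nhds hpos)] with ε hε
    have hy : y ∈ {y : UnitSphere3 | ε < dist x y} := hε
    rw [Set.indicator_of_mem hy]

/-- The sectoral harmonic `(y₀ + i y₁)ⁿ`. -/
def sectoralHarmonic (n : ℕ) : MvPolynomial (Fin 3) ℂ :=
  (MvPolynomial.X 0 + MvPolynomial.C Complex.I * MvPolynomial.X 1) ^ n

theorem isHomogeneous_sectoralHarmonic (n : ℕ) : (sectoralHarmonic n).IsHomogeneous n := by
  have h : (MvPolynomial.X 0 + MvPolynomial.C Complex.I * MvPolynomial.X 1 :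
      MvPolynomial (Fin 3) ℂ).IsHomogeneous 1 := by
    refine (MvPolynomial.isHomogeneous_X ℂ 0).add ?_
    simpa using (MvPolynomial.isHomogeneous_C (Fin 3) Complex.I).mul
      (MvPolynomial.isHomogeneous_X ℂ 1)
  simpa [sectoralHarmonic] using h.pow n

theorem polyLaplacian_sectoralHarmonic (n : ℕ) : polyLaplacian (sectoralHarmonic n) = 0 := by
  have hI : (MvPolynomial.C Complex.I * MvPolynomial.C Complex.I : MvPolynomial (Fin 3) ℂ) = -1 := by
    rw [← MvPolynomial.C_mul, Complex.I_mul_I]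
    simp
  simp only [polyLaplacian, sectoralHarmonic, Fin.sum_univ_three, MvPolynomial.pderiv_pow,
    MvPolynomial.pderiv_mul, MvPolynomial.pderiv_C, MvPolynomial.pderiv_X, map_add]
  simp
  linear_combination (n : MvPolynomial (Fin 3) ℂ) * ((n - 1 : ℕ) : MvPolynomial (Fin 3) ℂ) *
    (MvPolynomial.X 0 + MvPolynomial.C Complex.I * MvPolynomial.X 1) ^ (n - 1 - 1) * hI

/-- Uniqueness comes from evaluating at e₀, where the sectoral harmonic equals 1. -/
theorem eigenvalue_iff (n : ℕ) (k : ℝ) (z : ℂ) :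
    (∀ Y : UnitSphere3 → ℂ, IsSphericalHarmonic n Y →
      IsNeumannPoincareImage k Y (fun x => z * Y x)) ↔ z = npEigenvalue n k := by
  constructor
  · intro h
    have h1 := h (fun y => evalReal (sectoralHarmonic n) y)
      ⟨sectoralHarmonic n, isHomogeneous_sectoralHarmonic n, polyLaplacian_sectoralHarmonic n,
        fun _ => rfl⟩
    have h2 := isNeumannPoincareImage_evalReal k (isHomogeneous_sectoralHarmonic n)
      (polyLaplacian_sectoralHarmonic n)
    let e : UnitSphere3 := ⟨EuclideanSpace.single 0 1, by simp⟩
    have h3 := tendsto_nhds_unique (h1 e) (h2 e)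
    have h4 : evalReal (sectoralHarmonic n) e = 1 := by
      simp [e, evalReal, sectoralHarmonic]
    simpa [h4] using h3
  · rintro rfl Y ⟨p, hp, hL, hY⟩
    obtain rfl : Y = fun y : UnitSphere3 => evalReal p y := funext hY
    exact isNeumannPoincareImage_evalReal k hp hL

/-! ### The static term 1/r. -/

/-- The derivative of r(P_{n+1} + P_n) is ((2n+1)P_n − (2n+3)P_{n+1})/r. This primitive vanishes at
1, where r = 0, and at −1, where the two values cancel. Hence 2n + 1 times the integral is
independent of n. -/
theorem integral_legendreP_mul_inv_chord (n : ℕ) :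
    ∫ t in (-1 : ℝ)..1, (legendreP n).eval t * (chord t)⁻¹ = 2 / (2 * n + 1) := by
  have hi : ∀ p : Polynomial ℝ, IntervalIntegrable (fun t => p.eval t * (chord t)⁻¹)
      MeasureTheory.volume (-1) 1 := fun p =>
    ((intervalIntegrable_iff_integrableOn_Ioc_of_le (by norm_num)).2
      integrableOn_inv_chord).continuousOn_mul p.continuous.continuousOn
  have hchord : chord (-1) = 2 := by
    rw [chord, show (2 * (1 - -1) : ℝ) = 2 ^ 2 by norm_num, Real.sqrt_sq (by norm_num)]
  induction n with
  | zero =>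
    have h := intervalIntegral.integral_eq_sub_of_hasDerivAt_of_le (f := fun t => -chord t)
      (f' := fun t => (chord t)⁻¹) (by norm_num : (-1 : ℝ) ≤ 1) continuous_chord.neg.continuousOn
      (fun t ht => by simpa using (hasDerivAt_chord ht.2).fun_neg)
      ((intervalIntegrable_iff_integrableOn_Ioc_of_le (by norm_num)).2 integrableOn_inv_chord)
    simp [legendreP_zero, h, hchord, chord_one]
  | succ n ih =>
    have hd : ∀ t ∈ Set.Ioo (-1 : ℝ) 1, HasDerivAt
        (fun t => chord t * ((legendreP (n + 1)).eval t + (legendreP n).eval t))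
        ((2 * n + 1) * ((legendreP n).eval t * (chord t)⁻¹) -
          (2 * n + 3) * ((legendreP (n + 1)).eval t * (chord t)⁻¹)) t := by
      intro t ht
      have h := (hasDerivAt_chord ht.2).fun_mul
        (((legendreP (n + 1)).hasDerivAt t).fun_add ((legendreP n).hasDerivAt t))
      refine h.congr_deriv ?_
      have h1 := congrArg (Polynomial.eval t) (X_mul_derivative_legendreP_succ n)
      have h2 := congrArg (Polynomial.eval t) (derivative_legendreP_succ n)
      simp at h1 h2
      have hr := chord_pos ht.2
      have hsq := chord_sq ht.2.le
      field_simp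
      rw [hsq]
      linear_combination 2 * h2 - 2 * h1
    have h := intervalIntegral.integral_eq_sub_of_hasDerivAt_of_le (by norm_num : (-1 : ℝ) ≤ 1)
      (continuous_chord.mul
        ((legendreP (n + 1)).continuous.add (legendreP n).continuous)).continuousOn hd
      (((hi _).const_mul _).sub ((hi _).const_mul _))
    rw [intervalIntegral.integral_sub ((hi _).const_mul _) ((hi _).const_mul _),
      intervalIntegral.integral_const_mul, intervalIntegral.integral_const_mul, ih] at h
    simp [chord_one, eval_neg_one_legendreP_succ] at h
    push_cast
    have h3 : (2 * (n : ℝ) + 1) * (2 / (2 * n + 1)) = 2 := by field_simp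
    rw [h3] at h
    rw [eq_div_iff (by positivity)]
    linarith

/-! ### The remainder (e^{ikr} − 1)/r. -/

/-- With u = kr this is, up to sign, the numerator of `waveQuotientDeriv`. For |u| ≤ 1 factor out
e^{iu} and use Taylor for e^{−iu}; for |u| > 1 the trivial bound 2 + |u| forces the constant 3. -/
theorem norm_one_add_I_mul_mul_exp_sub_exp_le (u : ℝ) :
    ‖1 + Complex.I * u * Complex.exp (Complex.I * u) - Complex.exp (Complex.I * u)‖ ≤
      3 * u ^ 2 := by
  have he : ‖Complex.exp (Complex.I * u)‖ = 1 := by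
    rw [mul_comm, Complex.norm_exp_ofReal_mul_I]
  have hn : ‖Complex.I * (u : ℂ)‖ = |u| := by simp
  by_cases hu : |u| ≤ 1
  · have h1 : 1 + Complex.I * u * Complex.exp (Complex.I * u) - Complex.exp (Complex.I * u) =
        Complex.exp (Complex.I * u) *
          (Complex.exp (-(Complex.I * u)) - 1 - -(Complex.I * u)) := by
      have : Complex.exp (Complex.I * u) * Complex.exp (-(Complex.I * u)) = 1 := by
        rw [← Complex.exp_add, add_neg_cancel, Complex.exp_zero]
      linear_combination -this
    have h2 := Complex.norm_exp_sub_one_sub_id_le (x := -(Complex.I * u)) (by rwa [norm_neg, hn])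
    rw [h1, norm_mul, he, one_mul]
    rw [norm_neg, hn, sq_abs] at h2
    nlinarith [sq_nonneg u]
  · push Not at hu
    have h1 : ‖1 + Complex.I * u * Complex.exp (Complex.I * u) - Complex.exp (Complex.I * u)‖ ≤
        1 + |u| + 1 := by
      refine (norm_sub_le _ _).trans ?_
      rw [he]
      gcongr
      refine (norm_add_le _ _).trans ?_
      rw [norm_mul, he, hn]
      simp
    rw [← sq_abs u]
    nlinarith

/-- The difference quotient `(exp (i k r) - 1) / r` as a function of the inner product. -/
def waveQuotient (k t : ℝ) : ℂ := (chordWave k t - 1) / (chord t : ℂ)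

theorem norm_waveQuotient_le (k t : ℝ) : ‖waveQuotient k t‖ ≤ |k| := by
  have h : ‖chordWave k t - 1‖ ≤ |k| * chord t := by
    have h1 : chordWave k t = Complex.exp (Complex.I * ((k * chord t : ℝ) : ℂ)) := by
      rw [chordWave]
      push_cast
      ring_nf
    rw [h1]
    refine Real.norm_exp_I_mul_ofReal_sub_one_le.trans ?_
    rw [Real.norm_eq_abs, abs_mul, abs_of_nonneg (chord_nonneg t)]
  rw [waveQuotient, norm_div, Complex.norm_real, Real.norm_of_nonneg (chord_nonneg t)]
  exact div_le_of_le_mul₀ (chord_nonneg t) (abs_nonneg k) h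

/-- The derivative of `waveQuotient` with respect to the inner product. -/
def waveQuotientDeriv (k t : ℝ) : ℂ :=
  -(1 + Complex.I * k * (chord t : ℂ) * chordWave k t - chordWave k t) / (chord t : ℂ) ^ 3

theorem hasDerivAt_waveQuotient (k : ℝ) {t : ℝ} (ht : t < 1) :
    HasDerivAt (waveQuotient k) (waveQuotientDeriv k t) t := by
  have h0 : (chord t : ℂ) ≠ 0 := by exact_mod_cast (chord_pos ht).ne'
  have hc := (hasDerivAt_chord ht).ofReal_comp
  have he := (hc.const_mul (Complex.I * (k : ℂ))).cexp
  have h := (he.sub_const 1).fun_div hc h0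
  refine h.congr_deriv ?_
  rw [waveQuotientDeriv, chordWave]
  push_cast
  field_simp
  ring

theorem norm_waveQuotientDeriv_le (k : ℝ) {t : ℝ} (ht : t < 1) :
    ‖waveQuotientDeriv k t‖ ≤ 3 * k ^ 2 / chord t := by
  have hr := chord_pos ht
  have h := norm_one_add_I_mul_mul_exp_sub_exp_le (k * chord t)
  have h1 : Complex.I * ((k * chord t : ℝ) : ℂ) = Complex.I * k * (chord t : ℂ) := by
    push_cast
    ring
  rw [h1] at h
  rw [waveQuotientDeriv, norm_div, norm_neg, norm_pow, Complex.norm_real,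
    Real.norm_of_nonneg hr.le, chordWave, div_le_div_iff₀ (by positivity) hr]
  nlinarith

theorem measurable_chordWave (k : ℝ) : Measurable (chordWave k) :=
  (continuous_chordWave k).measurable

theorem measurable_ofReal_chord : Measurable fun t => (chord t : ℂ) :=
  (Complex.continuous_ofReal.comp continuous_chord).measurable

theorem measurable_waveQuotient (k : ℝ) : Measurable (waveQuotient k) :=
  ((measurable_chordWave k).sub_const 1).div measurable_ofReal_chord

theorem measurable_waveQuotientDeriv (k : ℝ) : Measurable (waveQuotientDeriv k) :=
  ((((measurable_ofReal_chord.const_mul _).mul (measurable_chordWave k)).const_add 1).sub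
    (measurable_chordWave k)).neg.div (measurable_ofReal_chord.pow_const 3)

theorem intervalIntegrable_waveQuotient_mul (k : ℝ) (p : Polynomial ℝ) :
    IntervalIntegrable (fun t => waveQuotient k t * ((p.eval t : ℝ) : ℂ))
      MeasureTheory.volume (-1) 1 := by
  have hp : Continuous fun t : ℝ => ((p.eval t : ℝ) : ℂ) := by fun_prop
  rw [intervalIntegrable_iff_integrableOn_Ioc_of_le (by norm_num)]
  refine MeasureTheory.Integrable.bdd_mul (c := |k|)
    (hp.integrableOn_Icc.mono_set Set.Ioc_subset_Icc_self)
    (measurable_waveQuotient k).aestronglyMeasurable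
    (Filter.Eventually.of_forall fun t => norm_waveQuotient_le k t)

/-- Weighted AM–GM on r|P_n′|, after 1 − t² = r²(1 + t)/2 has absorbed the 1/r from the derivative
bound. The choice s = √n later balances the two terms. -/
theorem norm_waveQuotientDeriv_mul_le (k : ℝ) (n : ℕ) {s t : ℝ} (hs : 0 < s)
    (ht : t ∈ Set.Ioo (-1 : ℝ) 1) :
    ‖waveQuotientDeriv k t * (((1 - t ^ 2) * (legendreP n).derivative.eval t : ℝ) : ℂ)‖ ≤
      3 * k ^ 2 / 4 * (s * (1 + t)) +
        3 * k ^ 2 / (2 * s) * ((1 - t ^ 2) * (legendreP n).derivative.eval t ^ 2) := by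
  set d := (legendreP n).derivative.eval t
  have hr := chord_pos ht.2
  have hsq := chord_sq ht.2.le
  have h1t : 0 ≤ 1 + t := by linarith [ht.1]
  have h1 : ‖waveQuotientDeriv k t * (((1 - t ^ 2) * d : ℝ) : ℂ)‖ ≤
      3 * k ^ 2 / chord t * ((1 - t ^ 2) * |d|) := by
    rw [norm_mul, Complex.norm_real, Real.norm_eq_abs, abs_mul,
      abs_of_nonneg (show 0 ≤ 1 - t ^ 2 by nlinarith [ht.1, ht.2])]
    gcongr
    · exact mul_nonneg (by nlinarith [ht.1, ht.2]) (abs_nonneg d)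
    · exact norm_waveQuotientDeriv_le k ht.2
  have h2 : 1 - t ^ 2 = chord t ^ 2 * (1 + t) / 2 := by
    rw [hsq]
    ring
  refine h1.trans ?_
  rw [h2, ← sq_abs d]
  have h3 : 0 ≤ 3 * k ^ 2 * (1 + t) / (4 * s) * (s - chord t * |d|) ^ 2 := by positivity
  have h4 : 3 * k ^ 2 / chord t * (chord t ^ 2 * (1 + t) / 2 * |d|) =
      3 * k ^ 2 / 4 * (s * (1 + t)) +
        3 * k ^ 2 / (2 * s) * (chord t ^ 2 * (1 + t) / 2 * |d| ^ 2) -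
      3 * k ^ 2 * (1 + t) / (4 * s) * (s - chord t * |d|) ^ 2 := by
    field_simp
    ring
  linarith

theorem norm_integral_waveQuotient_mul_legendreP_le (k : ℝ) {n : ℕ} (hn : 1 ≤ n) :
    (n : ℝ) * (n + 1) *
      ‖∫ t in (-1 : ℝ)..1, waveQuotient k t * (((legendreP n).eval t : ℝ) : ℂ)‖ ≤
        9 / 2 * k ^ 2 * Real.sqrt n := by
  set s := Real.sqrt n with hs
  have hn1 : (1 : ℝ) ≤ n := by exact_mod_cast hn
  have hs0 : 0 < s := Real.sqrt_pos.2 (by linarith)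
  have hs2 : s ^ 2 = n := Real.sq_sqrt (by linarith)
  set G : Polynomial ℝ := (1 - Polynomial.X ^ 2) * (legendreP n).derivative with hG
  have hGe : ∀ t : ℝ, G.eval t = (1 - t ^ 2) * (legendreP n).derivative.eval t := by
    intro t
    simp [hG]
  have hGd : ∀ t : ℝ, G.derivative.eval t = -(n * (n + 1)) * (legendreP n).eval t := by
    intro t
    rw [hG, derivative_one_sub_X_sq_mul_derivative_legendreP]
    simp
  set b : ℝ → ℝ := fun t => 3 * k ^ 2 / 4 * (s * (1 + t)) +
        3 * k ^ 2 / (2 * s) * ((1 - t ^ 2) * (legendreP n).derivative.eval t ^ 2) with hb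
  have hbc : Continuous b := by fun_prop
  have hbound : ∀ t ∈ Set.Ioo (-1 : ℝ) 1, ‖waveQuotientDeriv k t * ((G.eval t : ℝ) : ℂ)‖ ≤ b t := by
    intro t ht
    rw [hGe]
    exact norm_waveQuotientDeriv_mul_le k n hs0 ht
  have hae : ∀ᵐ t ∂MeasureTheory.volume, t ∈ Set.Ioc (-1 : ℝ) 1 →
      ‖waveQuotientDeriv k t * ((G.eval t : ℝ) : ℂ)‖ ≤ b t := by
    filter_upwards [MeasureTheory.Measure.ae_ne MeasureTheory.volume (1 : ℝ)] with t ht1 ht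
    exact hbound t ⟨ht.1, lt_of_le_of_ne ht.2 ht1⟩
  have hGm : Measurable fun t : ℝ => ((G.eval t : ℝ) : ℂ) :=
    (Complex.continuous_ofReal.comp G.continuous).measurable
  have hAi : IntervalIntegrable (fun t => waveQuotientDeriv k t * ((G.eval t : ℝ) : ℂ))
      MeasureTheory.volume (-1) 1 := by
    rw [intervalIntegrable_iff_integrableOn_Ioc_of_le (by norm_num)]
    refine MeasureTheory.Integrable.mono'
      (hbc.integrableOn_Icc.mono_set Set.Ioc_subset_Icc_self)
      ((measurable_waveQuotientDeriv k).mul hGm).aestronglyMeasurable ?_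
    exact (MeasureTheory.ae_restrict_iff' measurableSet_Ioc).2 hae
  have hBi := intervalIntegrable_waveQuotient_mul k G.derivative
  -- The product of `waveQuotient` and (1 − t²)P_n′ with 1/r cancelled: continuous up to t = 1 and
  -- zero at both ends, whereas `waveQuotient` takes the default value 0 at t = 1.
  have hFc : Continuous fun t : ℝ => (chordWave k t - 1) *
      ((chord t * (1 + t) / 2 * (legendreP n).derivative.eval t : ℝ) : ℂ) := by
    have := continuous_chord
    have := continuous_chordWave k
    fun_prop
  have hd : ∀ t ∈ Set.Ioo (-1 : ℝ) 1, HasDerivAt (fun t : ℝ => (chordWave k t - 1) *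
      ((chord t * (1 + t) / 2 * (legendreP n).derivative.eval t : ℝ) : ℂ))
      (waveQuotientDeriv k t * ((G.eval t : ℝ) : ℂ) +
        waveQuotient k t * ((G.derivative.eval t : ℝ) : ℂ)) t := by
    intro t ht
    refine ((hasDerivAt_waveQuotient k ht.2).fun_mul (G.hasDerivAt t).ofReal_comp).congr_of_eventuallyEq
      (Filter.eventuallyEq_of_mem (Iio_mem_nhds ht.2) fun u hu => ?_)
    have hr : (chord u : ℂ) ≠ 0 := by exact_mod_cast (chord_pos hu).ne'
    have hsq : (chord u : ℂ) ^ 2 = 2 * (1 - u) := by exact_mod_cast chord_sq (le_of_lt hu)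
    simp only [hGe, waveQuotient]
    push_cast
    field_simp
    rw [hsq]
    ring
  have h := intervalIntegral.integral_eq_sub_of_hasDerivAt_of_le (by norm_num : (-1 : ℝ) ≤ 1)
    hFc.continuousOn hd (hAi.add hBi)
  rw [intervalIntegral.integral_add hAi hBi] at h
  have hB : ∫ t in (-1 : ℝ)..1, waveQuotient k t * ((G.derivative.eval t : ℝ) : ℂ) =
      -((n : ℂ) * (n + 1)) *
        ∫ t in (-1 : ℝ)..1, waveQuotient k t * (((legendreP n).eval t : ℝ) : ℂ) := by
    rw [← intervalIntegral.integral_const_mul]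
    refine intervalIntegral.integral_congr fun t _ => ?_
    simp only [hGd]
    push_cast
    ring
  rw [hB] at h
  simp [chord_one] at h
  have hA := intervalIntegral.norm_integral_le_of_norm_le (by norm_num : (-1 : ℝ) ≤ 1) hae
    (hbc.intervalIntegrable _ _)
  have hbI : ∫ t in (-1 : ℝ)..1, b t = 3 * k ^ 2 / 2 * s +
      3 * k ^ 2 / (2 * s) * ((n : ℝ) * (n + 1) * (2 / (2 * n + 1))) := by
    simp only [hb]
    rw [intervalIntegral.integral_add (by apply Continuous.intervalIntegrable; fun_prop)
      (by apply Continuous.intervalIntegrable; fun_prop), intervalIntegral.integral_const_mul,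
      intervalIntegral.integral_const_mul, intervalIntegral.integral_const_mul,
      integral_one_sub_sq_mul_derivative_legendreP_sq,
      intervalIntegral.integral_add (by simp) (by simp)]
    norm_num
    ring
  -- With s² = n the terms are at most (3/2)k²s and 3k²s, whence 9/2.
  have hM : (n : ℝ) * (n + 1) * (2 / (2 * n + 1)) ≤ 2 * s ^ 2 := by
    rw [hs2, mul_div_assoc', div_le_iff₀ (by positivity)]
    nlinarith
  have hb2 : ∫ t in (-1 : ℝ)..1, b t ≤ 9 / 2 * k ^ 2 * s := by
    rw [hbI]
    have : 3 * k ^ 2 / (2 * s) * (2 * s ^ 2) = 3 * k ^ 2 * s := by field_simp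
    have h5 := mul_le_mul_of_nonneg_left hM (show 0 ≤ 3 * k ^ 2 / (2 * s) by positivity)
    rw [this] at h5
    linarith
  refine le_trans ?_ (hA.trans hb2)
  have hnn : ‖(n : ℂ) * (n + 1)‖ = (n : ℝ) * (n + 1) := by
    rw [norm_mul, Complex.norm_natCast, show ((n : ℂ) + 1) = ((n + 1 : ℕ) : ℂ) by push_cast; ring,
      Complex.norm_natCast]
    push_cast
    ring
  rw [← hnn, ← norm_mul, show (∫ t in (-1 : ℝ)..1, waveQuotientDeriv k t * ((G.eval t : ℝ) : ℂ)) =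
    (n : ℂ) * (n + 1) *
      ∫ t in (-1 : ℝ)..1, waveQuotient k t * (((legendreP n).eval t : ℝ) : ℂ) by
    linear_combination h]

/-! ### Assembling the expansion. -/

theorem npEigenvalue_sub_eq (n : ℕ) (k : ℝ) :
    npEigenvalue n k - (1 / (2 * (2 * (n : ℂ) + 1)) + Complex.I / 2 * (k : ℂ) * cCoeff n k) =
      1 / 4 * ∫ t in (-1 : ℝ)..1, waveQuotient k t * (((legendreP n).eval t : ℝ) : ℂ) := by
  have hP : Continuous fun t : ℝ => (((legendreP n).eval t : ℝ) : ℂ) := by fun_prop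
  have hw := continuous_chordWave k
  have hi1 : IntervalIntegrable (fun t => (((legendreP n).eval t : ℝ) : ℂ) * ((chord t : ℂ))⁻¹)
      MeasureTheory.volume (-1) 1 :=
    (intervalIntegrable_iff_integrableOn_Ioc_of_le (by norm_num)).2 hP.integrableOn_mul_inv_chord
  have hi2 := intervalIntegrable_waveQuotient_mul k (legendreP n)
  have hi3 : IntervalIntegrable (fun t => chordWave k t * (((legendreP n).eval t : ℝ) : ℂ))
      MeasureTheory.volume (-1) 1 := (hw.mul hP).intervalIntegrable _ _
  have hE : ∫ t in (-1 : ℝ)..1, (((legendreP n).eval t : ℝ) : ℂ) * ((chord t : ℂ))⁻¹ =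
      2 / (2 * n + 1) := by
    have h := congrArg (fun a : ℝ => (a : ℂ)) (integral_legendreP_mul_inv_chord n)
    simp only [← intervalIntegral.integral_ofReal] at h
    push_cast at h
    exact h
  -- The splitting of (1 − ikr)e^{ikr}/r needs r ≠ 0, so the integrands are compared on the open
  -- interval only.
  have hsplit : ∫ t in (-1 : ℝ)..1, npProfile k t * (((legendreP n).eval t : ℝ) : ℂ) =
      ∫ t in (-1 : ℝ)..1, (1 / (8 * Real.pi) *
        ((((legendreP n).eval t : ℝ) : ℂ) * ((chord t : ℂ))⁻¹ +
          waveQuotient k t * (((legendreP n).eval t : ℝ) : ℂ) -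
          Complex.I * k * (chordWave k t * (((legendreP n).eval t : ℝ) : ℂ)))) := by
    refine intervalIntegral.integral_congr_Ioo_of_le (by norm_num) fun t ht => ?_
    have h0 : (chord t : ℂ) ≠ 0 := by exact_mod_cast (chord_pos ht.2).ne'
    have hpi : (Real.pi : ℂ) ≠ 0 := by exact_mod_cast Real.pi_ne_zero
    simp only [npProfile, waveQuotient]
    field_simp
    ring
  rw [intervalIntegral.integral_const_mul,
    intervalIntegral.integral_sub (hi1.add hi2) (hi3.const_mul _),
    intervalIntegral.integral_add hi1 hi2, intervalIntegral.integral_const_mul, hE] at hsplit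
  have hc : cCoeff n k =
      -(1 / 2) * ∫ t in (-1 : ℝ)..1, chordWave k t * (((legendreP n).eval t : ℝ) : ℂ) := rfl
  rw [npEigenvalue, hsplit, hc]
  have hpi : (Real.pi : ℂ) ≠ 0 := by exact_mod_cast Real.pi_ne_zero
  have hn : (2 * (n : ℂ) + 1) ≠ 0 := by exact_mod_cast (show 2 * n + 1 ≠ 0 by omega)
  field_simp
  ring

theorem norm_npEigenvalue_sub_le {K k : ℝ} (hk : 0 ≤ k) (hkK : k ≤ K) {n : ℕ} (hn : 1 ≤ n) :
    ‖npEigenvalue n k - (1 / (2 * (2 * (n : ℂ) + 1)) + Complex.I / 2 * (k : ℂ) * cCoeff n k)‖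
      ≤ 9 / 8 * K * (k / (n : ℝ) ^ (3 / 2 : ℝ)) := by
  have hn1 : (1 : ℝ) ≤ n := by exact_mod_cast hn
  have h := norm_integral_waveQuotient_mul_legendreP_le k hn
  have hp : (n : ℝ) ^ (3 / 2 : ℝ) * Real.sqrt n = n ^ 2 := by
    rw [Real.sqrt_eq_rpow, ← Real.rpow_add (by linarith), ← Real.rpow_natCast]
    norm_num
  have hp0 : 0 < (n : ℝ) ^ (3 / 2 : ℝ) := Real.rpow_pos_of_pos (by linarith) _
  rw [npEigenvalue_sub_eq, norm_mul]
  set A := ‖∫ t in (-1 : ℝ)..1, waveQuotient k t * (((legendreP n).eval t : ℝ) : ℂ)‖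
  have hA : 0 ≤ A := norm_nonneg _
  have hs0 : 0 < Real.sqrt n := Real.sqrt_pos.2 (by linarith)
  have h1 : (n : ℝ) ^ (3 / 2 : ℝ) * A ≤ 9 / 2 * k ^ 2 := by
    refine le_of_mul_le_mul_right ?_ hs0
    calc _ = (n : ℝ) ^ 2 * A := by rw [← hp]; ring
      _ ≤ (n : ℝ) * (n + 1) * A := by
        gcongr
        nlinarith
      _ ≤ _ := h
  -- The constant is 9/8 = (1/4)(9/2), and k² ≤ Kk leaves a single power of k.
  rw [mul_div_assoc', le_div_iff₀ hp0]
  have h4 : ‖(1 / 4 : ℂ)‖ = 1 / 4 := by norm_num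
  rw [h4]
  nlinarith

end

theorem theorem3p4 :
    ∃ τ : ℕ → ℝ → ℂ,
      -- `τ n k` is the one number `z` with `(K_B^k)^*[Y] = z Y` for all spherical harmonics
      -- `Y` of order `n`
      (∀ (n : ℕ) (k : ℝ), 0 ≤ k → ∀ z : ℂ,
        (∀ Y : UnitSphere3 → ℂ, IsSphericalHarmonic n Y →
          IsNeumannPoincareImage k Y (fun x => z * Y x)) ↔ z = τ n k) ∧
      -- the expansion for large `n`, uniformly for bounded `k`
      (∀ K : ℝ, 0 < K → ∃ (C : ℝ) (N : ℕ), ∀ n : ℕ, N ≤ n → ∀ k : ℝ, 0 ≤ k → k ≤ K →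
        ‖τ n k - (1 / (2 * (2 * (n : ℂ) + 1)) + Complex.I / 2 * (k : ℂ) * cCoeff n k)‖
          ≤ C * (k / (n : ℝ) ^ (3 / 2 : ℝ))) ∧
      -- the bound on the coefficient
      (∀ (n : ℕ) (k : ℝ), 0 ≤ k → ‖cCoeff n k‖ ≤ 1 / Real.sqrt (2 * (n : ℝ) + 1)) :=
  ⟨npEigenvalue, fun n k _ z => eigenvalue_iff n k z,
    fun K _ => ⟨9 / 8 * K, 1, fun _ hn _ hk hkK => norm_npEigenvalue_sub_le hk hkK hn⟩,
    fun n k _ => norm_cCoeff_le n k⟩
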